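/- Let $\mathscr V$ be a symmetric monoidal closed category whose underlying category is locally small, complete and cocomplete, let $\mathscr C$ be a cocomplete, tensored and cotensored $\mathscr V$-category, and let $j:\mathscr J\to\mathscr C$ be a small subcategory of arities, i.e. a dense and fully faithful $\mathscr V$-functor with $\mathscr J$ small. Assume that $j$ is eleutheric: $\mathscr C$ has all weighted colimits with weights $\mathscr C(j-,C):\mathscr J^{\mathrm{op}}\to\mathscr V$ ($C\in\mathscr C$), and each $\mathscr C(jJ,-):\mathscr C\to\mathscr V$ ($J\in\mathscr J$) preserves them. A $\mathscr V$-monad on $\mathscr C$ is $\mathscr J$-ary if its endofunctor preserves these colimits; $\mathsf{Mnd}_{\mathscr J}(\mathscr C)$ denotes the category of $\mathscr J$-ary $\mathscr V$-monads. Write $\mathscr V\text{-}\mathsf{CAT}/\mathscr C$ for the (strict) slice category of $\mathscr V$-categories over $\mathscr C$ and $TJ$ for $T(jJ)$. A $\mathscr J$-signature is a family of objects of $\mathscr C$ indexed by the objects of $\mathscr J$; $\mathcal U$ is the forgetful functor from $\mathsf{Mnd}_{\mathscr J}(\mathscr C)$ to $\mathscr J$-signatures, $\mathcal U\mathbb T=(TJ)_J$,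 and a free $\mathscr J$-ary monad $\mathbb T_\Gamma$ on a signature $\Gamma$ is one with a universal arrow $\Gamma\to\mathcal U\mathbb T_\Gamma$. A system of $\mathscr J$-ary equations $(\mathbb T,E)$ is a $\mathscr J$-ary $\mathscr V$-monad $\mathbb T=(T,\eta,\mu)$ with a pair of morphisms of signatures $E=(t,u:\Gamma\rightrightarrows\mathcal U\mathbb T)$. It presents a $\mathscr J$-ary $\mathscr V$-monad $\mathbb T/E$ if $\mathbb T/E$ is an algebraic coequalizer of the induced pair $\overline t,\overline u:\mathbb T_\Gamma\rightrightarrows\mathbb T$, i.e. a coequalizer in $\mathsf{Mnd}_{\mathscr J}(\mathscr C)$ that the semantics functor $\mathsf{Alg}:\mathsf{Mnd}_{\mathscr J}(\mathscr C)^{\mathrm{op}}\to\mathscr V\text{-}\mathsf{CAT}/\mathscr C$ sends to an equalizer. For a $\mathbb T$-algebra $(A,a)$ let $[\![-]\!]^A_J:TJ\to[\mathscr C(jJ,A),A]$ be the transpose of $\mathscr C(jJ,A)\to\mathscr C(TJ,TA)\to\mathscr C(TJ,A)$ (the action of $T$ followed by composition with $a$), where $[X,A]$ denotes the cotensor; $(A,a)$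 satisfies $E$ if $[\![-]\!]^A_J\circ t_J=[\![-]\!]^A_J\circ u_J$ for all $J$. Let $(\mathbb T,E)\text{-}\mathsf{Alg}$ be the full sub-$\mathscr V$-category of $\mathbb T\text{-}\mathsf{Alg}$ on the algebras that satisfy $E$. For a signature $\Sigma$, a $\Sigma$-algebra is an object $A$ with morphisms $a_J:\mathscr C(jJ,A)\otimes\Sigma J\to A$ for all $J$; these form a $\mathscr V$-category $\Sigma\text{-}\mathsf{Alg}$ over $\mathscr C$, whose hom-object from $(A,a)$ to $(B,b)$ is the joint equalizer over $J$ of the two morphisms $\mathscr C(A,B)\rightrightarrows\mathscr C(\mathscr C(jJ,A)\otimes\Sigma J,B)$ induced by $a_J$ and $b_J$. A $\mathscr J$-presentation $P=(\Sigma,E)$ is a signature $\Sigma$ with a free $\mathscr J$-ary $\mathscr V$-monad $\mathbb T_\Sigma$ and a system of $\mathscr J$-ary equations $E$ over $\mathbb T_\Sigma$; it presents $\mathbb T_P=\mathbb T_\Sigma/E$. A $\mathbb T_\Sigma$-algebra $(A,a)$ and a $\Sigma$-algebra on $A$ correspond if the structure morphisms of the latter are the transposes of the composites $\mathscr C(jJ,A)\to\mathscr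 C(T_\Sigma J,T_\Sigma A)\to\mathscr C(T_\Sigma J,A)\to\mathscr C(\Sigma J,A)$ (the action of $T_\Sigma$, followed by composition with $a$ and with the unit $\Sigma J\to T_\Sigma J$). Let $P\text{-}\mathsf{Alg}$ be the full sub-$\mathscr V$-category of $\Sigma\text{-}\mathsf{Alg}$ on the $\Sigma$-algebras that correspond to a $\mathbb T_\Sigma$-algebra that satisfies $E$. Then: 1. For every system of $\mathscr J$-ary equations $(\mathbb T,E)$ and every $\mathscr J$-ary $\mathscr V$-monad $\mathbb T/E$ presented by it, $(\mathbb T/E)\text{-}\mathsf{Alg}\cong(\mathbb T,E)\text{-}\mathsf{Alg}$ in $\mathscr V\text{-}\mathsf{CAT}/\mathscr C$. 2. For every $\mathscr J$-presentation $P$ and every $\mathscr J$-ary $\mathscr V$-monad $\mathbb T_P$ presented by it, $\mathbb T_P\text{-}\mathsf{Alg}\cong P\text{-}\mathsf{Alg}$ in $\mathscr V\text{-}\mathsf{CAT}/\mathscr C$. -/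

import Mathlib

open CategoryTheory CategoryTheory.Limits MonoidalCategory Opposite
open scoped CategoryTheory.MonoidalClosed

universe v u w w₁ w₂ w₃

namespace JAry

noncomputable section

section Underlying

variable (V : Type u) [Category.{v} V] [MonoidalCategory V]
variable {C : Type w} [EnrichedCategory V C]

/-- Morphisms `A ⟶ B` of the underlying ordinary category of the `V`-category `C`. -/
abbrev Mor (A B : C) : Type v := 𝟙_ V ⟶ (A ⟶[V] B)

variable {V}

/-- Composition in the underlying ordinary category (in diagrammatic order). -/
def Mor.comp {A B D : C} (f : Mor V A B) (g : Mor V B D) : Mor V A D :=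
  (λ_ (𝟙_ V)).inv ≫ (f ⊗ₘ g) ≫ eComp V A B D

/-- Composition in the underlying ordinary category, in diagrammatic order. -/
infixr:80 " ⋄ " => Mor.comp

/-- `C(f, B) : C(A', B) ⟶ C(A, B)` for `f : A ⟶ A'`. -/
def homPre {A A' : C} (f : Mor V A A') (B : C) : (A' ⟶[V] B) ⟶ (A ⟶[V] B) :=
  (λ_ _).inv ≫ f ▷ _ ≫ eComp V A A' B

/-- `C(A, g) : C(A, B) ⟶ C(A, B')` for `g : B ⟶ B'`. -/
def homPost (A : C) {B B' : C} (g : Mor V B B') : (A ⟶[V] B) ⟶ (A ⟶[V] B') :=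
  (ρ_ _).inv ≫ _ ◁ g ≫ eComp V A B B'

/-- The action of a `V`-functor on morphisms of the underlying ordinary category. -/
def mapMor {D : Type w₁} [EnrichedCategory V D] (F : EnrichedFunctor V C D) {A B : C}
    (f : Mor V A B) : Mor V (F.obj A) (F.obj B) :=
  f ≫ F.map A B

theorem eComp_homPre {A A' B D : C} (f : Mor V A A') :
    eComp V A' B D ≫ homPre f D = homPre f B ▷ _ ≫ eComp V A B D := by
  simp only [homPre, comp_whiskerRight, Category.assoc]
  rw [leftUnitor_inv_naturality_assoc, whisker_exchange_assoc, ← e_assoc V A A' B D]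
  simp [e_assoc']

theorem eComp_homPost {A B D D' : C} (g : Mor V D D') :
    eComp V A B D ≫ homPost A g = _ ◁ homPost B g ≫ eComp V A B D' := by
  simp only [homPost, MonoidalCategory.whiskerLeft_comp, Category.assoc]
  rw [rightUnitor_inv_naturality_assoc, ← whisker_exchange_assoc, ← e_assoc' V A B D D']
  simp

theorem homPost_eComp {A B B' D : C} (g : Mor V B B') :
    homPost A g ▷ _ ≫ eComp V A B' D = _ ◁ homPre g D ≫ eComp V A B D := by
  simp only [homPre, homPost, comp_whiskerRight, MonoidalCategory.whiskerLeft_comp,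
    Category.assoc]
  rw [← e_assoc' V A B B' D]
  simp

theorem Mor.comp_eq_pre {A B D : C} (f : Mor V A B) (g : Mor V B D) :
    f ⋄ g = g ≫ homPre f D := by
  rw [Mor.comp, homPre, leftUnitor_inv_naturality_assoc, tensorHom_def']
  simp

theorem Mor.comp_eq_post {A B D : C} (f : Mor V A B) (g : Mor V B D) :
    f ⋄ g = f ≫ homPost A g := by
  rw [Mor.comp, homPost, rightUnitor_inv_naturality_assoc, MonoidalCategory.tensorHom_def, unitors_inv_equal]
  simp

@[simp]
theorem homPre_id (A B : C) : homPre (eId V A) B = 𝟙 _ := by simp [homPre]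

@[simp]
theorem homPost_id (A B : C) : homPost A (eId V B) = 𝟙 _ := by simp [homPost]

theorem homPre_homPost {A A' B B' : C} (f : Mor V A A') (g : Mor V B B') :
    homPre f B ≫ homPost A g = homPost A' g ≫ homPre f B' := by
  rw [homPost, homPost, rightUnitor_inv_naturality_assoc, ← whisker_exchange_assoc,
    Category.assoc, Category.assoc, eComp_homPre]

@[simp]
theorem Mor.id_comp {A B : C} (f : Mor V A B) : eId V A ⋄ f = f := by
  rw [Mor.comp_eq_pre, homPre_id, Category.comp_id]

@[simp]
theorem Mor.comp_id {A B : C} (f : Mor V A B) : f ⋄ eId V B = f := by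
  rw [Mor.comp_eq_post, homPost_id, Category.comp_id]

theorem Mor.assoc {A B D E : C} (f : Mor V A B) (g : Mor V B D) (h : Mor V D E) :
    (f ⋄ g) ⋄ h = f ⋄ g ⋄ h := by
  rw [Mor.comp_eq_post (f ⋄ g), Mor.comp_eq_pre f g, Category.assoc, homPre_homPost,
    Mor.comp_eq_pre f, Mor.comp_eq_post g, Category.assoc]

theorem homPre_comp {A B D : C} (f : Mor V A B) (g : Mor V B D) (E : C) :
    homPre (f ⋄ g) E = homPre g E ≫ homPre f E := by
  conv_rhs => rw [homPre, Category.assoc, Category.assoc, eComp_homPre, ← comp_whiskerRight_assoc,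
    ← Mor.comp_eq_pre]
  rfl

theorem homPost_comp (A : C) {B D E : C} (f : Mor V B D) (g : Mor V D E) :
    homPost A (f ⋄ g) = homPost A f ≫ homPost A g := by
  conv_rhs => rw [homPost, Category.assoc, Category.assoc, eComp_homPost,
    ← MonoidalCategory.whiskerLeft_comp_assoc, ← Mor.comp_eq_post]
  rfl

variable {D : Type w₁} [EnrichedCategory V D]

theorem homPre_map (F : EnrichedFunctor V C D) {A A' : C} (f : Mor V A A') (B : C) :
    homPre f B ≫ F.map A B = F.map A' B ≫ homPre (mapMor F f) (F.obj B) := by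
  simp only [homPre, mapMor, Category.assoc, F.map_comp, comp_whiskerRight]
  rw [leftUnitor_inv_naturality_assoc, tensorHom_def', whisker_exchange_assoc,
    Category.assoc, whisker_exchange_assoc]

theorem homPost_map (F : EnrichedFunctor V C D) (A : C) {B B' : C} (g : Mor V B B') :
    homPost A g ≫ F.map A B' = F.map A B ≫ homPost (F.obj A) (mapMor F g) := by
  simp only [homPost, mapMor, Category.assoc, F.map_comp, MonoidalCategory.whiskerLeft_comp]
  rw [rightUnitor_inv_naturality_assoc, MonoidalCategory.tensorHom_def, ← whisker_exchange_assoc,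
    Category.assoc, ← whisker_exchange_assoc]

@[simp]
theorem mapMor_id (F : EnrichedFunctor V C D) (A : C) :
    mapMor F (eId V A) = eId V (F.obj A) := F.map_id A

theorem mapMor_comp (F : EnrichedFunctor V C D) {A B E : C} (f : Mor V A B) (g : Mor V B E) :
    mapMor F (f ⋄ g) = mapMor F f ⋄ mapMor F g := by
  rw [Mor.comp_eq_pre, Mor.comp_eq_pre, mapMor, mapMor, Category.assoc, homPre_map, Category.assoc]

end Underlying

section VNat

variable {V : Type u} [Category.{v} V] [MonoidalCategory V]
variable {C : Type w} [EnrichedCategory V C] {D : Type w₁} [EnrichedCategory V D]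

/-- A `V`-natural transformation between `V`-functors. (For a general `V` this is stronger than
a natural transformation between the underlying ordinary functors.) -/
@[ext]
structure VNatTrans (F G : EnrichedFunctor V C D) where
  /-- the components, as morphisms of the underlying ordinary category of `D` -/
  app (A : C) : Mor V (F.obj A) (G.obj A)
  naturality (A B : C) :
    F.map A B ≫ homPost (F.obj A) (app B) = G.map A B ≫ homPre (app A) (G.obj B)

/-- Identity `V`-natural transformation. -/
@[simps]
def VNatTrans.id (F : EnrichedFunctor V C D) : VNatTrans F F where
  app A := eId V (F.obj A)
  naturality A B := by simp

/-- Vertical composition of `V`-natural transformations. -/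
@[simps]
def VNatTrans.comp {F G H : EnrichedFunctor V C D} (α : VNatTrans F G) (β : VNatTrans G H) :
    VNatTrans F H where
  app A := α.app A ⋄ β.app A
  naturality A B := by
    rw [homPost_comp, ← Category.assoc, α.naturality, Category.assoc, homPre_homPost,
      ← Category.assoc, β.naturality, Category.assoc, homPre_comp]

theorem VNatTrans.nat {F G : EnrichedFunctor V C D} (α : VNatTrans F G) {A B : C} (f : Mor V A B) :
    mapMor F f ⋄ α.app B = α.app A ⋄ mapMor G f := by
  rw [Mor.comp_eq_post, Mor.comp_eq_pre, mapMor, mapMor, Category.assoc, Category.assoc,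
    α.naturality]

/-- Two `V`-functors into `A` that agree on objects and become equal after composition with a
faithful `V`-functor `U` are equal. -/
theorem EnrichedFunctor_eq_of_faithful {A : Type w₁} [EnrichedCategory V A]
    {B : Type w₂} [EnrichedCategory V B] (U : EnrichedFunctor V A C)
    (hU : ∀ X Y, Mono (U.map X Y)) {F G : EnrichedFunctor V B A}
    (hobj : ∀ X, F.obj X = G.obj X) (h : F.comp V U = G.comp V U) : F = G := by
  obtain ⟨Fo, Fm, _, _⟩ := F
  obtain ⟨Go, Gm, _, _⟩ := G
  obtain rfl : Fo = Go := funext hobj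
  congr 1
  funext X Y
  have := hU (Fo X) (Fo Y)
  rw [← cancel_mono (U.map (Fo X) (Fo Y))]
  have h' := (EnrichedFunctor.mk.inj h).2
  exact congrFun (congrFun (eq_of_heq h') X) Y

end VNat

section VCat

section

variable {V : Type u} [Category.{v} V] [MonoidalCategory V]
variable {A : Type w} [EnrichedCategory V A] {B : Type w₁} [EnrichedCategory V B]
  {D : Type w₂} [EnrichedCategory V D] {E : Type w₃} [EnrichedCategory V E]

theorem vfunctor_id_comp (F : EnrichedFunctor V A B) : (EnrichedFunctor.id V A).comp V F = F := by
  cases F; simp [EnrichedFunctor.comp, EnrichedFunctor.id]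

theorem vfunctor_comp_id (F : EnrichedFunctor V A B) : F.comp V (EnrichedFunctor.id V B) = F := by
  cases F; simp [EnrichedFunctor.comp, EnrichedFunctor.id]

theorem vfunctor_assoc (F : EnrichedFunctor V A B) (G : EnrichedFunctor V B D)
    (H : EnrichedFunctor V D E) : (F.comp V G).comp V H = F.comp V (G.comp V H) := by
  simp [EnrichedFunctor.comp]

end

variable (V : Type u) [Category.{v} V] [MonoidalCategory V]
variable (C : Type w) [EnrichedCategory V C]

/-- A `V`-category over `C`: a `V`-category together with a `V`-functor to `C`. -/
structure VCatOver where
  /-- the objects -/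
  Obj : Type w₁
  /-- the `V`-category structure -/
  [str : EnrichedCategory V Obj]
  /-- the structural `V`-functor to `C` -/
  functor : EnrichedFunctor V Obj C

attribute [instance] VCatOver.str

variable {V C}

/-- A morphism of `V`-categories over `C`: a `V`-functor strictly commuting with the structural
`V`-functors to `C`. -/
@[ext]
structure VCatOver.Hom (X Y : VCatOver.{v, u, w, w₁} V C) where
  /-- the underlying `V`-functor -/
  fnctr : EnrichedFunctor V X.Obj Y.Obj
  comm : fnctr.comp V Y.functor = X.functor

/-- The slice category `V-CAT/C` of (possibly large) `V`-categories over `C`. -/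
instance : Category (VCatOver.{v, u, w, w₁} V C) where
  Hom X Y := VCatOver.Hom X Y
  id X := ⟨EnrichedFunctor.id V X.Obj, vfunctor_id_comp _⟩
  comp {X Y Z} F G := ⟨F.fnctr.comp V G.fnctr, by rw [vfunctor_assoc, G.comm, F.comm]⟩
  id_comp F := VCatOver.Hom.ext (vfunctor_id_comp _)
  comp_id F := VCatOver.Hom.ext (vfunctor_comp_id _)
  assoc F G H := VCatOver.Hom.ext (vfunctor_assoc _ _ _)

/-- The objects of `A` that satisfy `P`. -/
def FullSub {A : Type w₁} (P : A → Prop) : Type w₁ := {X : A // P X}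

/-- The full sub-`V`-category on the objects that satisfy `P`: the hom-objects, identities and
composition are those of the ambient `V`-category. -/
instance {A : Type w₁} [EnrichedCategory V A] (P : A → Prop) :
    EnrichedCategory V (FullSub P) where
  Hom X Y := X.1 ⟶[V] Y.1
  id X := eId V X.1
  comp X Y Z := eComp V X.1 Y.1 Z.1
  id_comp X Y := e_id_comp V X.1 Y.1
  comp_id X Y := e_comp_id V X.1 Y.1
  assoc W X Y Z := e_assoc V W.1 X.1 Y.1 Z.1

/-- The inclusion of a full sub-`V`-category. -/
@[simps]
def fullSubInclusion {A : Type w₁} [EnrichedCategory V A] (P : A → Prop) :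
    EnrichedFunctor V (FullSub P) A where
  obj X := X.1
  map X Y := 𝟙 (X.1 ⟶[V] Y.1)
  map_id X := Category.comp_id _
  map_comp X Y Z := by
    refine (Category.comp_id _).trans ?_
    erw [id_tensorHom_id, Category.id_comp]
    rfl

/-- A full sub-`V`-category of a `V`-category over `C`, regarded as a `V`-category over `C`. -/
def VCatOver.full (X : VCatOver.{v, u, w, w₁} V C) (P : X.Obj → Prop) :
    VCatOver.{v, u, w, w₁} V C where
  Obj := FullSub P
  functor := (fullSubInclusion P).comp V X.functor

/-- Data presenting a `V`-category with a faithful `V`-functor to `C`: a family of subobjects of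
the hom-objects of `C` that is closed under composition and contains the identities. -/
structure SubHoms {α : Type w₁} (U : α → C) where
  /-- the hom-objects -/
  hom : α → α → V
  /-- their inclusions -/
  ι (a b : α) : hom a b ⟶ (U a ⟶[V] U b)
  mono (a b : α) : Mono (ι a b)
  /-- the identities -/
  id (a : α) : 𝟙_ V ⟶ hom a a
  id_ι (a : α) : id a ≫ ι a a = eId V (U a)
  /-- the composition -/
  comp (a b c : α) : hom a b ⊗ hom b c ⟶ hom a c
  comp_ι (a b c : α) : comp a b c ≫ ι a c = (ι a b ⊗ₘ ι b c) ≫ eComp V (U a) (U b) (U c)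

/-- The `V`-category given by a family of subobjects of the hom-objects of `C`. -/
@[reducible]
def SubHoms.enriched {α : Type w₁} {U : α → C} (S : SubHoms (V := V) U) :
    EnrichedCategory V α where
  Hom := S.hom
  id := S.id
  comp := S.comp
  id_comp a b := by
    have := S.mono a b
    rw [← cancel_mono (S.ι a b)]
    simp only [Category.assoc, S.comp_ι, Category.id_comp]
    rw [MonoidalCategory.tensorHom_def, Category.assoc, ← comp_whiskerRight_assoc, S.id_ι,
      ← whisker_exchange_assoc, ← leftUnitor_inv_naturality_assoc, e_id_comp, Category.comp_id]
  comp_id a b := by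
    have := S.mono a b
    rw [← cancel_mono (S.ι a b)]
    simp only [Category.assoc, S.comp_ι, Category.id_comp]
    rw [tensorHom_def', Category.assoc, ← MonoidalCategory.whiskerLeft_comp_assoc, S.id_ι,
      whisker_exchange_assoc, ← rightUnitor_inv_naturality_assoc, e_comp_id, Category.comp_id]
  assoc a b c d := by
    have := S.mono a d
    rw [← cancel_mono (S.ι a d)]
    simp only [Category.assoc, S.comp_ι]
    simp only [MonoidalCategory.tensorHom_def, Category.assoc]
    rw [← comp_whiskerRight_assoc, S.comp_ι, whisker_exchange_assoc,
      ← MonoidalCategory.whiskerLeft_comp_assoc, S.comp_ι]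
    simp only [MonoidalCategory.tensorHom_def, comp_whiskerRight,
      MonoidalCategory.whiskerLeft_comp, Category.assoc]
    rw [← whisker_exchange_assoc, ← e_assoc]
    simp

/-- The faithful `V`-functor to `C`. -/
@[reducible]
def SubHoms.forget {α : Type w₁} {U : α → C} (S : SubHoms (V := V) U) :
    letI := S.enriched
    EnrichedFunctor V α C :=
  letI := S.enriched
  { obj := U
    map := S.ι
    map_id := S.id_ι
    map_comp := S.comp_ι }

/-- A `V`-functor over `C` between `V`-categories given by subobjects of hom-objects of `C`. -/
@[reducible]
def SubHoms.lift {α : Type w₁} {β : Type w₂} {U : β → C} (φ : α → β)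
    (S : SubHoms (V := V) (fun a => U (φ a))) (S' : SubHoms (V := V) U)
    (m : ∀ a b, S.hom a b ⟶ S'.hom (φ a) (φ b)) (hm : ∀ a b, m a b ≫ S'.ι _ _ = S.ι a b) :
    letI := S.enriched
    letI := S'.enriched
    EnrichedFunctor V α β :=
  letI := S.enriched
  letI := S'.enriched
  { obj := φ
    map := m
    map_id := fun a => by
      have := S'.mono (φ a) (φ a)
      refine (cancel_mono (S'.ι (φ a) (φ a))).1 ?_
      refine (Category.assoc _ _ _).trans ?_
      rw [hm]
      exact (S.id_ι a).trans (S'.id_ι (φ a)).symm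
    map_comp := fun a b c => by
      have := S'.mono (φ a) (φ c)
      refine (cancel_mono (S'.ι (φ a) (φ c))).1 ?_
      refine (Category.assoc _ _ _).trans ?_
      rw [hm]
      refine (S.comp_ι a b c).trans ?_
      refine Eq.trans ?_ (Category.assoc _ _ _).symm
      refine Eq.trans ?_ (congrArg (fun t => (m a b ⊗ₘ m b c) ≫ t) (S'.comp_ι _ _ _)).symm
      rw [tensorHom_comp_tensorHom_assoc, hm, hm] }

end VCat

section Monads

variable (V : Type u) [Category.{v} V] [MonoidalCategory V]
variable (C : Type w) [EnrichedCategory V C]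

/-- A `V`-monad on `C`. -/
structure VMonad where
  /-- the underlying `V`-endofunctor -/
  T : EnrichedFunctor V C C
  /-- the unit -/
  η (A : C) : Mor V A (T.obj A)
  /-- the multiplication -/
  μ (A : C) : Mor V (T.obj (T.obj A)) (T.obj A)
  /-- the unit is `V`-natural `1 ⟶ T` -/
  η_naturality (A B : C) : homPost A (η B) = T.map A B ≫ homPre (η A) (T.obj B)
  /-- the multiplication is `V`-natural `T ∘ T ⟶ T` -/
  μ_naturality (A B : C) :
    T.map A B ≫ T.map (T.obj A) (T.obj B) ≫ homPost (T.obj (T.obj A)) (μ B) =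
      T.map A B ≫ homPre (μ A) (T.obj B)
  left_unit (A : C) : η (T.obj A) ⋄ μ A = eId V (T.obj A)
  right_unit (A : C) : mapMor T (η A) ⋄ μ A = eId V (T.obj A)
  assoc (A : C) : mapMor T (μ A) ⋄ μ A = μ (T.obj A) ⋄ μ A

variable {V C}

/-- A morphism of `V`-monads: a `V`-natural transformation compatible with units and
multiplications. -/
@[ext]
structure VMonad.Hom (S T : VMonad V C) where
  /-- the underlying `V`-natural transformation -/
  trans : VNatTrans S.T T.T
  unit (A : C) : S.η A ⋄ trans.app A = T.η A
  mult (A : C) : S.μ A ⋄ trans.app A =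
    trans.app (S.T.obj A) ⋄ mapMor T.T (trans.app A) ⋄ T.μ A

/-- The category `Mnd(C)` of `V`-monads on `C`. -/
instance : Category (VMonad V C) where
  Hom := VMonad.Hom
  id T := ⟨VNatTrans.id T.T, fun A => by simp, fun A => by simp⟩
  comp {R S T} σ τ := ⟨σ.trans.comp τ.trans, fun A => by
      simp [← Mor.assoc, σ.unit, τ.unit], fun A => by
      simp only [VNatTrans.comp_app, mapMor_comp]
      rw [← Mor.assoc, σ.mult, Mor.assoc, Mor.assoc, τ.mult]
      simp only [Mor.assoc]
      rw [← Mor.assoc (mapMor S.T _), τ.trans.nat]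
      simp only [Mor.assoc]⟩
  id_comp σ := VMonad.Hom.ext (VNatTrans.ext (funext fun A => by simp))
  comp_id σ := VMonad.Hom.ext (VNatTrans.ext (funext fun A => by simp))
  assoc σ τ ρ := VMonad.Hom.ext (VNatTrans.ext (funext fun A => by simp [Mor.assoc]))

/-- An (Eilenberg-Moore) algebra for a `V`-monad. -/
@[ext]
structure VMonad.Algebra (T : VMonad V C) where
  /-- the underlying object -/
  A : C
  /-- the structure morphism -/
  a : Mor V (T.T.obj A) A
  unit : T.η A ⋄ a = eId V A
  assoc : T.μ A ⋄ a = mapMor T.T a ⋄ a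

theorem hom_closed (P : EnrichedFunctor V C C) {A B D : C} {a : Mor V (P.obj A) A}
    {b : Mor V (P.obj B) B} {d : Mor V (P.obj D) D} {X Y : V} {f : X ⟶ (A ⟶[V] B)}
    {g : Y ⟶ (B ⟶[V] D)} (hf : f ≫ homPre a B = f ≫ P.map A B ≫ homPost (P.obj A) b)
    (hg : g ≫ homPre b D = g ≫ P.map B D ≫ homPost (P.obj B) d) :
    ((f ⊗ₘ g) ≫ eComp V A B D) ≫ homPre a D =
      ((f ⊗ₘ g) ≫ eComp V A B D) ≫ P.map A D ≫ homPost (P.obj A) d := by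
  simp only [Category.assoc, P.map_comp_assoc, eComp_homPre, eComp_homPost]
  have e1 : (f ⊗ₘ g) ≫ homPre a B ▷ _ = f ≫ homPre a B ⊗ₘ g := by
    simp [MonoidalCategory.tensorHom_def, whisker_exchange]
  have e2 : ∀ {Z W : V} (p : (B ⟶[V] D) ⟶ Z) (q : Z ⟶ W),
      (f ⊗ₘ g) ≫ (P.map A B ⊗ₘ p) ≫ _ ◁ q = (f ≫ P.map A B) ⊗ₘ (g ≫ p ≫ q) := by
    intro Z W p q
    simp [← id_tensorHom]
  rw [reassoc_of% e1, hf, reassoc_of% e2, ← hg]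
  have e3 : (f ≫ P.map A B ≫ homPost (P.obj A) b ⊗ₘ g) =
      (f ≫ P.map A B ⊗ₘ g) ≫ homPost (P.obj A) b ▷ _ := by
    simp [← tensorHom_id]
  have e4 : (f ≫ P.map A B ⊗ₘ g ≫ homPre b D) =
      (f ≫ P.map A B ⊗ₘ g) ≫ _ ◁ homPre b D := by
    simp [← id_tensorHom]
  rw [e3, e4, Category.assoc, Category.assoc, homPost_eComp]

theorem hom_id (P : EnrichedFunctor V C C) {A : C} (a : Mor V (P.obj A) A) :
    eId V A ≫ homPre a A = eId V A ≫ P.map A A ≫ homPost (P.obj A) a := by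
  rw [← Mor.comp_eq_pre, P.map_id_assoc, ← Mor.comp_eq_post]
  simp

variable [HasEqualizers V]

/-- The hom-objects of the `V`-category `T-Alg`: `T-Alg((A, a), (B, b))` is the equalizer of
`C(a, B) : C(A, B) ⟶ C(TA, B)` and `C(TA, b) ∘ T : C(A, B) ⟶ C(TA, TB) ⟶ C(TA, B)`. -/
def VMonad.algHoms (T : VMonad V C) :
    SubHoms (V := V) (fun X : T.Algebra => X.A) where
  hom X Y := equalizer (homPre X.a Y.A) (T.T.map X.A Y.A ≫ homPost (T.T.obj X.A) Y.a)
  ι _ _ := equalizer.ι _ _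
  mono _ _ := inferInstance
  id X := equalizer.lift (eId V X.A) (hom_id T.T X.a)
  id_ι _ := equalizer.lift_ι _ _
  comp X Y Z := equalizer.lift ((equalizer.ι _ _ ⊗ₘ equalizer.ι _ _) ≫ eComp V X.A Y.A Z.A)
    (hom_closed T.T (equalizer.condition _ _) (equalizer.condition _ _))
  comp_ι _ _ _ := equalizer.lift_ι _ _

/-- The `V`-category `T-Alg` of algebras for a `V`-monad. -/
instance (T : VMonad V C) : EnrichedCategory V T.Algebra := T.algHoms.enriched

/-- `T-Alg` with its forgetful `V`-functor, as a `V`-category over `C`. -/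
def VMonad.alg (T : VMonad V C) : VCatOver.{v, u, w, max w v} V C where
  Obj := T.Algebra
  functor := T.algHoms.forget

/-- The algebra `(A, a ∘ τ_A)` for `τ : S ⟶ T` and a `T`-algebra `(A, a)`. -/
@[simps]
def VMonad.Algebra.restrict {S T : VMonad V C} (τ : S ⟶ T) (X : T.Algebra) : S.Algebra where
  A := X.A
  a := τ.trans.app X.A ⋄ X.a
  unit := by rw [← Mor.assoc, τ.unit, X.unit]
  assoc := by
    rw [← Mor.assoc, τ.mult, mapMor_comp]
    simp only [Mor.assoc]
    rw [X.assoc, ← Mor.assoc (mapMor S.T X.a), τ.trans.nat, Mor.assoc,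
      ← Mor.assoc (mapMor S.T (τ.trans.app X.A)), τ.trans.nat, Mor.assoc]

theorem algRestrict_condition {S T : VMonad V C} (τ : S ⟶ T) (X Y : T.Algebra) :
    T.algHoms.ι X Y ≫ homPre (τ.trans.app X.A ⋄ X.a) Y.A =
      T.algHoms.ι X Y ≫ S.T.map X.A Y.A ≫ homPost (S.T.obj X.A) (τ.trans.app Y.A ⋄ Y.a) := by
  have h : T.algHoms.ι X Y ≫ homPre X.a Y.A =
    T.algHoms.ι X Y ≫ T.T.map X.A Y.A ≫ homPost (T.T.obj X.A) Y.a := equalizer.condition _ _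
  simp only [homPre_comp, homPost_comp]
  rw [reassoc_of% h, reassoc_of% (τ.trans.naturality X.A Y.A), homPre_homPost]

/-- The `V`-functor `τ^* : T-Alg ⟶ S-Alg` over `C` induced by `τ : S ⟶ T`. It is the identity on
subobjects of the hom-objects of `C`. -/
def algRestrict {S T : VMonad V C} (τ : S ⟶ T) : EnrichedFunctor V T.Algebra S.Algebra :=
  SubHoms.lift (U := fun X : S.Algebra => X.A) (fun X : T.Algebra => X.restrict τ)
    T.algHoms S.algHoms
    (fun X Y => equalizer.lift (T.algHoms.ι X Y) (algRestrict_condition τ X Y))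
    (fun _ _ => equalizer.lift_ι _ _)

theorem algRestrict_comp_forget {S T : VMonad V C} (τ : S ⟶ T) :
    (algRestrict τ).comp V S.algHoms.forget = T.algHoms.forget := by
  refine EnrichedFunctor.ext V (fun _ => rfl) (fun X Y => ?_)
  refine (Category.comp_id _).trans ?_
  exact equalizer.lift_ι _ _

variable (V C)

/-- The semantics functor `Alg : Mnd(C)ᵒᵖ ⥤ V-CAT/C`. -/
def Alg : (VMonad V C)ᵒᵖ ⥤ VCatOver.{v, u, w, max w v} V C where
  obj T := T.unop.alg
  map {T S} τ := ⟨algRestrict τ.unop, algRestrict_comp_forget τ.unop⟩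
  map_id T := VCatOver.Hom.ext (EnrichedFunctor_eq_of_faithful T.unop.algHoms.forget
    T.unop.algHoms.mono (fun X => VMonad.Algebra.ext rfl (heq_of_eq (Mor.id_comp X.a)))
    ((algRestrict_comp_forget _).trans (vfunctor_id_comp _).symm))
  map_comp {R S T} σ τ := VCatOver.Hom.ext (EnrichedFunctor_eq_of_faithful T.unop.algHoms.forget
    T.unop.algHoms.mono (fun X => VMonad.Algebra.ext rfl (heq_of_eq (Mor.assoc _ _ _)))
    ((algRestrict_comp_forget _).trans (by
      refine Eq.trans ?_ (vfunctor_assoc _ _ _).symm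
      refine Eq.trans ?_ (congrArg _ (algRestrict_comp_forget τ.unop)).symm
      exact (algRestrict_comp_forget σ.unop).symm)))

end Monads

section Tensors

variable {V : Type u} [Category.{v} V] [MonoidalCategory V] {C : Type w} [EnrichedCategory V C]

/-- A tensor `X ⊗ M` of `M : C` by `X : V`: an object with a morphism `X ⟶ C(M, X ⊗ M)` inducing
isomorphisms `C(X ⊗ M, B) ≅ [X, C(M, B)]` in `V`, which is expressed on generalized elements. -/
structure Tensor (X : V) (M : C) where
  /-- the tensor `X ⊗ M` -/
  obj : C
  /-- the unit `X ⟶ C(M, X ⊗ M)` -/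
  unit : X ⟶ (M ⟶[V] obj)
  /-- the transpose of `Z ⟶ [X, C(M, B)]` -/
  desc {Z : V} {B : C} (f : X ⊗ Z ⟶ (M ⟶[V] B)) : Z ⟶ (obj ⟶[V] B)
  fac {Z : V} {B : C} (f : X ⊗ Z ⟶ (M ⟶[V] B)) : (unit ⊗ₘ desc f) ≫ eComp V M obj B = f
  uniq {Z : V} {B : C} (f : X ⊗ Z ⟶ (M ⟶[V] B)) (g : Z ⟶ (obj ⟶[V] B))
    (hg : (unit ⊗ₘ g) ≫ eComp V M obj B = f) : g = desc f

/-- A cotensor `[X, A]` of `A : C` by `X : V`: an object with a morphism `X ⟶ C([X, A], A)`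
inducing isomorphisms `C(B, [X, A]) ≅ [X, C(B, A)]` in `V`, which is expressed on generalized
elements. -/
structure Cotensor (X : V) (A : C) where
  /-- the cotensor `[X, A]` -/
  obj : C
  /-- the counit `X ⟶ C([X, A], A)` -/
  counit : X ⟶ (obj ⟶[V] A)
  /-- the transpose of `Z ⟶ [X, C(B, A)]` -/
  lift {Z : V} {B : C} (f : Z ⊗ X ⟶ (B ⟶[V] A)) : Z ⟶ (B ⟶[V] obj)
  fac {Z : V} {B : C} (f : Z ⊗ X ⟶ (B ⟶[V] A)) : (lift f ⊗ₘ counit) ≫ eComp V B obj A = f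
  uniq {Z : V} {B : C} (f : Z ⊗ X ⟶ (B ⟶[V] A)) (g : Z ⟶ (B ⟶[V] obj))
    (hg : (g ⊗ₘ counit) ≫ eComp V B obj A = f) : g = lift f

theorem Tensor.hom_ext {X : V} {M : C} (t : Tensor X M) {Z : V} {B : C}
    {g h : Z ⟶ (t.obj ⟶[V] B)} (e : (t.unit ⊗ₘ g) ≫ eComp V M t.obj B =
      (t.unit ⊗ₘ h) ≫ eComp V M t.obj B) : g = h :=
  (t.uniq _ g e).trans (t.uniq _ h rfl).symm

end Tensors

section Braided

variable {V : Type u} [Category.{v} V] [MonoidalCategory V] [BraidedCategory V]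
variable {C : Type w} [EnrichedCategory V C] {J : Type w₁} [EnrichedCategory V J]

theorem braid_aux (P p q : V) :
    P ◁ (β_ p q).hom ≫ (β_ P (q ⊗ p)).hom =
      (α_ _ _ _).inv ≫ (β_ P p).hom ▷ q ≫ (β_ (p ⊗ P) q).hom ≫ (α_ _ _ _).inv := by
  rw [BraidedCategory.braiding_naturality_right, BraidedCategory.braiding_tensor_right_hom,
    BraidedCategory.braiding_tensor_left_hom]
  simp

theorem repWeight_aux (j : EnrichedFunctor V J C) (A : C) (x y z : J) :
    (j.obj x ⟶[V] A) ◁ ((β_ (y ⟶[V] x) (z ⟶[V] y)).hom ≫ eComp V z y x) ≫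
      (β_ (j.obj x ⟶[V] A) (z ⟶[V] x)).hom ≫ j.map z x ▷ _ ≫ eComp V (j.obj z) (j.obj x) A =
    (α_ _ _ _).inv ≫ ((β_ (j.obj x ⟶[V] A) (y ⟶[V] x)).hom ≫ j.map y x ▷ _ ≫
      eComp V (j.obj y) (j.obj x) A) ▷ (z ⟶[V] y) ≫
      (β_ (j.obj y ⟶[V] A) (z ⟶[V] y)).hom ≫ j.map z y ▷ _ ≫ eComp V (j.obj z) (j.obj y) A := by
  rw [MonoidalCategory.whiskerLeft_comp, Category.assoc,
    BraidedCategory.braiding_naturality_right_assoc, reassoc_of% braid_aux,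
    ← comp_whiskerRight_assoc, j.map_comp]
  simp only [comp_whiskerRight, Category.assoc]
  rw [BraidedCategory.braiding_naturality_left_assoc, BraidedCategory.braiding_naturality_left_assoc]
  rw [BraidedCategory.braiding_naturality_left_assoc, ← e_assoc' V (j.obj z) (j.obj y) (j.obj x) A,
    whisker_exchange_assoc, MonoidalCategory.tensorHom_def']
  simp only [comp_whiskerRight, Category.assoc, whisker_assoc, whiskerRight_tensor,
    Iso.inv_hom_id_assoc]
  rw [BraidedCategory.braiding_naturality_left_assoc]

end Braided

section Closed

variable {V : Type u} [Category.{v} V] [MonoidalCategory V] [MonoidalClosed V]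

theorem ev_ev {A B D X Y : V} (p : A ⊗ X ⟶ B) (q : B ⊗ Y ⟶ D) :
    A ◁ (MonoidalClosed.curry p ⊗ₘ MonoidalClosed.curry q) ≫ (α_ _ _ _).inv ≫
      (ihom.ev A).app B ▷ _ ≫ (ihom.ev B).app D = (α_ _ _ _).inv ≫ p ▷ Y ≫ q := by
  rw [MonoidalCategory.tensorHom_def, MonoidalCategory.whiskerLeft_comp, Category.assoc,
    associator_inv_naturality_right_assoc, whisker_exchange_assoc,
    associator_inv_naturality_middle_assoc, ← comp_whiskerRight_assoc]
  erw [MonoidalClosed.whiskerLeft_curry_ihom_ev_app, MonoidalClosed.whiskerLeft_curry_ihom_ev_app]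

/-- A `V`-functor `B ⟶ V` from its transposed action on hom-objects. -/
@[simps, reducible]
def vFunctorOfAct {B : Type w₁} [EnrichedCategory V B] (F : B → V)
    (act : ∀ X Y : B, F X ⊗ (X ⟶[V] Y) ⟶ F Y)
    (act_id : ∀ X, F X ◁ eId V X ≫ act X X = (ρ_ (F X)).hom)
    (act_comp : ∀ X Y Z, F X ◁ eComp V X Y Z ≫ act X Z =
      (α_ _ _ _).inv ≫ act X Y ▷ _ ≫ act Y Z) : EnrichedFunctor V B V where
  obj := F
  map X Y := MonoidalClosed.curry (act X Y)
  map_id X := by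
    rw [← MonoidalClosed.curry_natural_left, act_id]
    rfl
  map_comp X Y Z := by
    rw [← MonoidalClosed.curry_natural_left, act_comp, MonoidalClosed.enrichedCategorySelf_comp,
      MonoidalClosed.comp_eq, MonoidalClosed.compTranspose_eq]
    refine Eq.trans ?_ (MonoidalClosed.curry_natural_left _ _)
    congr 1
    exact (ev_ev _ _).symm

variable {C : Type w} [EnrichedCategory V C]

/-- The hom `V`-functor `C(A, -) : C ⟶ V`. -/
def homFunctor (A : C) : EnrichedFunctor V C V :=
  vFunctorOfAct (fun X => (A ⟶[V] X)) (fun X Y => eComp V A X Y)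
    (fun X => by rw [← cancel_epi (ρ_ _).inv, e_comp_id, Iso.inv_hom_id])
    (fun X Y Z => (e_assoc V A X Y Z).symm)

/-- The `V`-functor `(-) ⊗ M : V ⟶ C`. -/
def tensorFunctor (ten : ∀ (X : V) (M : C), Tensor X M) (M : C) : EnrichedFunctor V V C where
  obj X := (ten X M).obj
  map X Y := (ten X M).desc ((ihom.ev X).app Y ≫ (ten Y M).unit)
  map_id X := by
    apply (ten X M).hom_ext
    rw [← whiskerLeft_comp_tensorHom, Category.assoc, (ten X M).fac,
      MonoidalCategory.tensorHom_def, Category.assoc]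
    have h : X ◁ eId V X ≫ (ihom.ev X).app X = (ρ_ X).hom :=
      MonoidalClosed.whiskerLeft_curry_ihom_ev_app _ _ _
    have h' : (_ ◁ eId V (ten X M).obj) ≫ eComp V M (ten X M).obj (ten X M).obj = (ρ_ _).hom := by
      rw [← cancel_epi (ρ_ _).inv, e_comp_id, Iso.inv_hom_id]
    rw [reassoc_of% h, h', rightUnitor_naturality]
  map_comp X Y Z := by
    apply (ten X M).hom_ext
    rw [← whiskerLeft_comp_tensorHom, Category.assoc, (ten X M).fac]
    have h : X ◁ eComp V X Y Z ≫ (ihom.ev X).app Z =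
        (α_ _ _ _).inv ≫ (ihom.ev X).app Y ▷ _ ≫ (ihom.ev Y).app Z :=
      MonoidalClosed.whiskerLeft_curry_ihom_ev_app _ _ _
    rw [reassoc_of% h]
    have h1 := (ten X M).fac ((ihom.ev X).app Y ≫ (ten Y M).unit)
    have h2 := (ten Y M).fac ((ihom.ev Y).app Z ≫ (ten Z M).unit)
    generalize (ten X M).desc ((ihom.ev X).app Y ≫ (ten Y M).unit) = d₁ at h1 ⊢
    generalize (ten Y M).desc ((ihom.ev Y).app Z ≫ (ten Z M).unit) = d₂ at h2 ⊢
    have h3 : ((ten X M).unit ⊗ₘ (d₁ ⊗ₘ d₂) ≫ eComp V _ _ _) ≫ eComp V M _ _ =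
        (α_ _ _ _).inv ≫ (((ten X M).unit ⊗ₘ d₁) ≫ eComp V M _ _ ⊗ₘ d₂) ≫ eComp V M _ _ := by
      rw [← tensorHom_comp_whiskerLeft, Category.assoc, ← e_assoc,
        ← tensorHom_comp_whiskerRight]
      simp
    refine Eq.trans ?_ h3.symm
    rw [h1, MonoidalCategory.tensorHom_def, comp_whiskerRight]
    simp only [Category.assoc]
    rw [← MonoidalCategory.tensorHom_def_assoc, h2]

end Closed

section Weighted

variable {V : Type u} [Category.{v} V] [MonoidalCategory V] [MonoidalClosed V]
  [SymmetricCategory V]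
variable {B : Type w₁} [EnrichedCategory V B] {C : Type w} [EnrichedCategory V C]

/-- The action `B(a, b) ⊗ W b ⟶ W a` of a weight `W : Bᵒᵖ ⟶ V`, i.e. the transpose of
`B(a, b) ⟶ [W b, W a]`. -/
def weightAct (W : EnrichedFunctor V Bᵒᵖ V) (a b : B) :
    (a ⟶[V] b) ⊗ W.obj (op b) ⟶ W.obj (op a) :=
  (β_ _ _).hom ≫ MonoidalClosed.uncurry (W.map (op b) (op a))

/-- `V`-naturality in `b` of a family `W b ⟶ [Z, C(D b, X)]`, written with the transposes
`W b ⊗ Z ⟶ C(D b, X)`. -/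
def IsVNatural (W : EnrichedFunctor V Bᵒᵖ V) (D : EnrichedFunctor V B C) (Z : V) (X : C)
    (f : ∀ b, W.obj (op b) ⊗ Z ⟶ (D.obj b ⟶[V] X)) : Prop :=
  ∀ a b : B, (D.map a b ⊗ₘ f b) ≫ eComp V (D.obj a) (D.obj b) X =
    (α_ _ _ _).inv ≫ weightAct W a b ▷ Z ≫ f a

/-- A cylinder with vertex `K` for the weight `W` and the diagram `D`: a `V`-natural
transformation `W ⟶ C(D-, K)`. -/
structure Cylinder (W : EnrichedFunctor V Bᵒᵖ V) (D : EnrichedFunctor V B C) (K : C) where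
  /-- the components -/
  app (b : B) : W.obj (op b) ⟶ (D.obj b ⟶[V] K)
  naturality (a b : B) : (D.map a b ⊗ₘ app b) ≫ eComp V (D.obj a) (D.obj b) K =
    weightAct W a b ≫ app a

/-- The cylinder exhibits `K` as the weighted colimit `W * D`: for all `X`, the induced morphisms
`C(K, X) ⟶ [W b, C(D b, X)]` exhibit `C(K, X)` as the object of `V`-natural transformations
`W ⟶ C(D-, X)`, which is expressed on generalized elements. -/
def Cylinder.IsColimit {W : EnrichedFunctor V Bᵒᵖ V} {D : EnrichedFunctor V B C} {K : C}
    (l : Cylinder W D K) : Prop :=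
  ∀ (X : C) (Z : V) (f : ∀ b, W.obj (op b) ⊗ Z ⟶ (D.obj b ⟶[V] X)), IsVNatural W D Z X f →
    ∃! g : Z ⟶ (K ⟶[V] X), ∀ b, (l.app b ⊗ₘ g) ≫ eComp V (D.obj b) K X = f b

/-- The weighted colimit `W * D` exists. -/
def HasWColimit (W : EnrichedFunctor V Bᵒᵖ V) (D : EnrichedFunctor V B C) : Prop :=
  ∃ (K : C) (l : Cylinder W D K), l.IsColimit

variable {E : Type w₂} [EnrichedCategory V E]

/-- The image of a cylinder under a `V`-functor. -/
def Cylinder.map {W : EnrichedFunctor V Bᵒᵖ V} {D : EnrichedFunctor V B C} {K : C}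
    (l : Cylinder W D K) (F : EnrichedFunctor V C E) : Cylinder W (D.comp V F) (F.obj K) where
  app b := l.app b ≫ F.map (D.obj b) K
  naturality a b := by
    have h := l.naturality a b =≫ F.map (D.obj a) K
    rw [Category.assoc, F.map_comp, tensorHom_comp_tensorHom_assoc, Category.assoc] at h
    exact h

/-- `F` preserves the weighted colimit `W * D`. -/
def PreservesWColimit (F : EnrichedFunctor V C E) (W : EnrichedFunctor V Bᵒᵖ V)
    (D : EnrichedFunctor V B C) : Prop :=
  ∀ (K : C) (l : Cylinder W D K), l.IsColimit → (l.map F).IsColimit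

variable (V C) in
/-- The `V`-category `C` is cocomplete: it has all weighted colimits with small weights. -/
def IsCocomplete : Prop :=
  ∀ (B : Type v) [EnrichedCategory V B] (W : EnrichedFunctor V Bᵒᵖ V) (D : EnrichedFunctor V B C),
    HasWColimit W D

variable {J : Type w₁} [EnrichedCategory V J] (j : EnrichedFunctor V J C)

/-- The weight `C(j-, A) : Jᵒᵖ ⟶ V`. -/
def repWeight (A : C) : EnrichedFunctor V Jᵒᵖ V :=
  vFunctorOfAct (fun X => (j.obj X.unop ⟶[V] A))
    (fun X Y => (β_ _ _).hom ≫ j.map Y.unop X.unop ▷ _ ≫ eComp V _ _ _)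
    (fun X => by
      have h := e_id_comp V (j.obj X.unop) A
      have h' : eId V X = eId V X.unop := rfl
      rw [h', BraidedCategory.braiding_naturality_right_assoc, ← comp_whiskerRight_assoc,
        j.map_id, braiding_tensorUnit_right]
      rw [Category.assoc, h, Category.comp_id])
    (fun X Y Z => repWeight_aux j A X.unop Y.unop Z.unop)

theorem weightAct_repWeight (A : C) (a b : J) : weightAct (repWeight j A) a b =
    j.map a b ▷ _ ≫ eComp V (j.obj a) (j.obj b) A :=
  (congrArg (fun t => (β_ (a ⟶[V] b) (j.obj b ⟶[V] A)).hom ≫ t)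
    (MonoidalClosed.uncurry_curry _)).trans (SymmetricCategory.symmetry_assoc _ _ _)

/-- The canonical cylinder with vertex `A` for `(C(j-, A), j)`, consisting of identities. -/
def canonicalCylinder (A : C) : Cylinder (repWeight j A) j A where
  app b := 𝟙 (j.obj b ⟶[V] A)
  naturality a b := by
    rw [weightAct_repWeight]
    refine Eq.trans ?_ (Category.comp_id _).symm
    rw [← tensorHom_id]
    rfl

/-- `j` is dense: each `A : C` is the colimit of `j` weighted by `C(j-, A)` via the canonical
cylinder; equivalently, `A ↦ C(j-, A)` is fully faithful. -/
def IsDense : Prop := ∀ A : C, (canonicalCylinder j A).IsColimit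

/-- `j : J ⟶ C` is a subcategory of arities: it is dense and fully faithful. -/
structure IsSubcategoryOfArities : Prop where
  dense : IsDense j
  fullyFaithful (a b : J) : IsIso (j.map a b)

/-- `H` is `J`-ary: it preserves the weighted colimits with weights `C(j-, A)`, `A : C`. -/
def IsJAry (H : EnrichedFunctor V C E) : Prop :=
  ∀ (A : C) (D : EnrichedFunctor V J C), PreservesWColimit H (repWeight j A) D

/-- `j` is eleutheric: `C` has all weighted colimits with weights `C(j-, A)`, `A : C`, and
each `C(j a, -) : C ⟶ V` preserves them. -/
structure IsEleutheric : Prop where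
  hasColimit (A : C) (D : EnrichedFunctor V J C) : HasWColimit (repWeight j A) D
  preserves (a : J) (A : C) (D : EnrichedFunctor V J C) :
    PreservesWColimit (homFunctor (V := V) (j.obj a)) (repWeight j A) D

end Weighted

section JAryMonads

variable {V : Type u} [Category.{v} V] [MonoidalCategory V] [MonoidalClosed V]
  [SymmetricCategory V]
variable {C : Type w} [EnrichedCategory V C]
variable {J : Type w₁} [EnrichedCategory V J] (j : EnrichedFunctor V J C)

/-- The category `Mnd_J(C)` of `J`-ary `V`-monads on `C`, a full subcategory of `Mnd(C)`. -/
abbrev JMonad := ObjectProperty.FullSubcategory (fun T : VMonad V C => IsJAry j T.T)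

/-- The restricted semantics functor `Alg : Mnd_J(C)ᵒᵖ ⥤ V-CAT/C`. -/
def JAlg [HasEqualizers V] : (JMonad j)ᵒᵖ ⥤ VCatOver.{v, u, w, max w v} V C :=
  (ObjectProperty.ι (fun T : VMonad V C => IsJAry j T.T)).op ⋙ Alg V C

/-- A cocone on a diagram `M` in `Mnd_J(C)` is an algebraic colimit of `M` if it is a colimit that
the restricted semantics functor sends to a limit. -/
def IsAlgebraicColimit [HasEqualizers V] {K : Type w₂} [Category.{w₃} K] {M : K ⥤ JMonad j}
    (c : Cocone M) : Prop :=
  Nonempty (Limits.IsColimit c) ∧ Nonempty (Limits.IsLimit ((JAlg j).mapCone c.op))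

/-- `J`-signatures in `C`: families of objects of `C` indexed by the objects of `J`. -/
def Sig (_ : EnrichedFunctor V J C) : Type (max w w₁) := J → C

/-- The category `Sig_J(C)`, a power of the underlying ordinary category of `C`. -/
instance : Category (Sig j) where
  Hom Γ Δ := ∀ a : J, Mor V (Γ a) (Δ a)
  id Γ a := eId V (Γ a)
  comp f g a := f a ⋄ g a
  id_comp f := funext fun a => Mor.id_comp (f a)
  comp_id f := funext fun a => Mor.comp_id (f a)
  assoc f g h := funext fun a => Mor.assoc (f a) (g a) (h a)

/-- The forgetful functor `𝒰 : Mnd_J(C) ⥤ Sig_J(C)`, sending `T` to the family `T (j a)`. -/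
def sigOf : JMonad j ⥤ Sig j where
  obj T a := T.obj.T.obj (j.obj a)
  map τ a := τ.hom.trans.app (j.obj a)
  map_id _ := rfl
  map_comp _ _ := rfl

/-- The data of a free `J`-ary `V`-monad `T_Γ` on a `J`-signature `Γ`: a universal arrow
`Γ ⟶ 𝒰 T_Γ`. -/
structure FreeJMonad (Γ : Sig j) where
  /-- the monad `T_Γ` -/
  monad : JMonad j
  /-- the unit `Γ ⟶ 𝒰 T_Γ` -/
  unit : Γ ⟶ (sigOf j).obj monad
  /-- the universal property -/
  universal : (StructuredArrow.mk (T := sigOf j) unit).IsUniversal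

variable {j}

/-- The morphism `T_Γ ⟶ T` of `J`-ary monads induced by a morphism of signatures `Γ ⟶ 𝒰 T`. -/
def FreeJMonad.desc {Γ : Sig j} (F : FreeJMonad j Γ) {T : JMonad j} (t : Γ ⟶ (sigOf j).obj T) :
    F.monad ⟶ T :=
  F.universal.desc (StructuredArrow.mk t)

/-- A system of `J`-ary equations `E = (t, u : Γ ⇉ 𝒰 T)` over a `J`-ary `V`-monad `T`. -/
structure EquationSystem (T : JMonad j) where
  /-- the signature of equations -/
  Γ : Sig j
  /-- the left-hand sides -/
  t : Γ ⟶ (sigOf j).obj T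
  /-- the right-hand sides -/
  u : Γ ⟶ (sigOf j).obj T

/-- `S` is a quotient `T/E` (is presented by `(T, E)`): it is an algebraic coequalizer in `Mnd_J(C)`
of the pair `T_Γ ⇉ T` induced by `t, u : Γ ⇉ 𝒰 T`. -/
def EquationSystem.IsQuotient [HasEqualizers V] {T : JMonad j} (E : EquationSystem T)
    (S : JMonad j) : Prop :=
  ∃ (F : FreeJMonad j E.Γ) (q : T ⟶ S) (w : F.desc E.t ≫ q = F.desc E.u ≫ q),
    IsAlgebraicColimit j (Cofork.ofπ q w)

/-- The interpretation morphism `⟦-⟧ : T J ⟶ [C(J, A), A]` of a `T`-algebra `(A, a)` at the object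
`J = j b`: the transpose of
`C(J, A) ⟶ C(T J, T A) ⟶ C(T J, A)`. -/
def interp (cot : ∀ (X : V) (A : C), Cotensor X A) {T : JMonad j} (X : T.obj.Algebra) (b : J) :
    Mor V (T.obj.T.obj (j.obj b)) (cot (j.obj b ⟶[V] X.A) X.A).obj :=
  (cot (j.obj b ⟶[V] X.A) X.A).lift ((λ_ (j.obj b ⟶[V] X.A)).hom ≫
    T.obj.T.map (j.obj b) X.A ≫ homPost (T.obj.T.obj (j.obj b)) X.a)

/-- A `T`-algebra satisfies `E` if the interpretations of the two sides of each equation agree. -/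
def EquationSystem.Satisfies (cot : ∀ (X : V) (A : C), Cotensor X A) {T : JMonad j}
    (E : EquationSystem T) (X : T.obj.Algebra) : Prop :=
  ∀ b : J, E.t b ⋄ interp cot X b = E.u b ⋄ interp cot X b

/-- The `V`-category `(T, E)-Alg` over `C`: the full sub-`V`-category of `T-Alg` on the algebras
that satisfy `E`. -/
def EquationSystem.alg [HasEqualizers V] (cot : ∀ (X : V) (A : C), Cotensor X A) {T : JMonad j}
    (E : EquationSystem T) : VCatOver.{v, u, w, max w v} V C :=
  T.obj.alg.full (E.Satisfies cot)

end JAryMonads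

section Signatures

variable {V : Type u} [Category.{v} V] [MonoidalCategory V] [MonoidalClosed V]
  [SymmetricCategory V]
variable {C : Type w} [EnrichedCategory V C]
variable {J : Type v} [EnrichedCategory V J] {j : EnrichedFunctor V J C}

/-- The `V`-endofunctor `C(j b, -) ⊗ S b` of `C`. -/
abbrev sigFunctor (ten : ∀ (X : V) (M : C), Tensor X M) (S : Sig j) (b : J) :
    EnrichedFunctor V C C :=
  (homFunctor (V := V) (j.obj b)).comp V (tensorFunctor ten (S b))

/-- A `Σ`-algebra for a `J`-signature `Σ`: an object `A` with morphisms `C(j b, A) ⊗ Σ b ⟶ A`. -/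
@[ext]
structure SigAlgebra (ten : ∀ (X : V) (M : C), Tensor X M) (S : Sig j) where
  /-- the underlying object -/
  A : C
  /-- the structure morphisms -/
  a (b : J) : Mor V (ten (j.obj b ⟶[V] A) (S b)).obj A

variable [HasEqualizers V] [HasProducts.{v} V]

/-- The hom-objects of the `V`-category `Σ-Alg`: `Σ-Alg(A, B)` is the joint equalizer, over all
`c : J`, of `C(a_c, B) : C(A, B) ⟶ C(C(j c, A) ⊗ Σ c, B)` and
`C(1, b_c) ∘ (C(j c, -) ⊗ Σ c) : C(A, B) ⟶ C(C(j c, A) ⊗ Σ c, B)`. -/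
def sigHoms (ten : ∀ (X : V) (M : C), Tensor X M) (S : Sig j) :
    SubHoms (V := V) (fun X : SigAlgebra ten S => X.A) where
  hom X Y := equalizer
    (Pi.lift fun c => homPre (X.a c) Y.A)
    (Pi.lift fun c => (sigFunctor ten S c).map X.A Y.A ≫
      homPost ((sigFunctor ten S c).obj X.A) (Y.a c))
  ι _ _ := equalizer.ι _ _
  mono _ _ := inferInstance
  id X := equalizer.lift (eId V X.A) (by
    refine Pi.hom_ext _ _ fun c => ?_
    simp only [Category.assoc, Pi.lift_π]
    exact hom_id (sigFunctor ten S c) (X.a c))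
  id_ι _ := equalizer.lift_ι _ _
  comp X Y Z := equalizer.lift ((equalizer.ι _ _ ⊗ₘ equalizer.ι _ _) ≫ eComp V X.A Y.A Z.A) (by
    refine Pi.hom_ext _ _ fun c => ?_
    simp only [Category.assoc, Pi.lift_π]
    have h1 := equalizer.condition (Pi.lift fun c => homPre (X.a c) Y.A)
      (Pi.lift fun c => (sigFunctor ten S c).map X.A Y.A ≫
        homPost ((sigFunctor ten S c).obj X.A) (Y.a c)) =≫ Pi.π _ c
    have h2 := equalizer.condition (Pi.lift fun c => homPre (Y.a c) Z.A)
      (Pi.lift fun c => (sigFunctor ten S c).map Y.A Z.A ≫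
        homPost ((sigFunctor ten S c).obj Y.A) (Z.a c)) =≫ Pi.π _ c
    simp only [Category.assoc, Pi.lift_π] at h1 h2
    have h3 := hom_closed (sigFunctor ten S c) h1 h2
    simp only [Category.assoc] at h3
    exact h3)
  comp_ι _ _ _ := equalizer.lift_ι _ _

/-- The `V`-category `Σ-Alg` of `Σ`-algebras. -/
instance (ten : ∀ (X : V) (M : C), Tensor X M) (S : Sig j) :
    EnrichedCategory V (SigAlgebra ten S) := (sigHoms ten S).enriched

/-- `Σ-Alg` with its forgetful `V`-functor, as a `V`-category over `C`. -/
def sigAlg (ten : ∀ (X : V) (M : C), Tensor X M) (S : Sig j) :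
    VCatOver.{v, u, w, max w v} V C where
  Obj := SigAlgebra ten S
  functor := (sigHoms ten S).forget

/-- The `Σ`-algebra underlying a `T`-algebra `(A, a)`, for a morphism `s : Σ ⟶ 𝒰 T`: its structure
morphisms `C(J, A) ⊗ Σ J ⟶ A`, `J = j b`, are the transposes of
`C(J, A) ⟶ C(T J, T A) ⟶ C(T J, A) ⟶ C(Σ J, A)`. -/
def underlyingSigAlgebra (ten : ∀ (X : V) (M : C), Tensor X M) {S : Sig j} {T : JMonad j}
    (s : S ⟶ (sigOf j).obj T) (X : T.obj.Algebra) : SigAlgebra ten S where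
  A := X.A
  a b := (ten (j.obj b ⟶[V] X.A) (S b)).desc ((ρ_ (j.obj b ⟶[V] X.A)).hom ≫
    T.obj.T.map (j.obj b) X.A ≫ homPost (T.obj.T.obj (j.obj b)) X.a ≫ homPre (s b) X.A)

variable (j) in
/-- A `J`-presentation `P = (Σ, E)`: a `J`-signature `Σ` with a system `E` of `J`-ary equations over
the free `J`-ary `V`-monad `T_Σ` on `Σ`. -/
structure Presentation where
  /-- the signature `Σ` -/
  sig : Sig j
  /-- the free `J`-ary `V`-monad `T_Σ` -/
  free : FreeJMonad j sig
  /-- the equations -/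
  E : EquationSystem free.monad

/-- The `J`-ary `V`-monad `S` is presented by `P = (Σ, E)`: it is a quotient `T_Σ/E`. -/
def Presentation.Presents (P : Presentation j) (S : JMonad j) : Prop := P.E.IsQuotient S

/-- A `Σ`-algebra is a `P`-algebra if its corresponding `T_Σ`-algebra satisfies `E`. -/
def Presentation.IsAlgebra (cot : ∀ (X : V) (A : C), Cotensor X A)
    (ten : ∀ (X : V) (M : C), Tensor X M) (P : Presentation j) (X : SigAlgebra ten P.sig) : Prop :=
  ∃ Y : P.free.monad.obj.Algebra, underlyingSigAlgebra ten P.free.unit Y = X ∧ P.E.Satisfies cot Y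

/-- The `V`-category `P-Alg` over `C`: the full sub-`V`-category of `Σ-Alg` on the `P`-algebras. -/
def Presentation.alg (cot : ∀ (X : V) (A : C), Cotensor X A)
    (ten : ∀ (X : V) (M : C), Tensor X M) (P : Presentation j) :
    VCatOver.{v, u, w, max w v} V C :=
  (sigAlg ten P.sig).full (P.IsAlgebra cot ten)

end Signatures

end

end JAry

open JAry

/-! Everything rests on one fact about a free `J`-ary monad `T_Σ`: a generalized morphism `f : Z ⟶
C(A, B)` between `T_Σ`-algebras that commutes with the generating operations `Σ a` is a homomorphism
of `T_Σ`-algebras (`FreeJMonad.comp_homPre_eq`). Hence `T_Σ-Alg ⟶ Σ-Alg` is fully faithful, and, by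
applying the fact to identities, injective on objects (`underlyingSigAlgebra_injective`).

To prove the fact, let `E a` be the equalizer inside `T_Σ (j a)` of the two morphisms to the
cotensor `[C(j a, A) ⊗ Z, B]` given by "apply the operation, then `f`" and "apply `f`, then the
operation" (`actThen`, `thenAct`). So `E a` consists of the operations of arity `a` that `f`
preserves. It exists because `C` is cocomplete and `j` is dense (`IsDense.exists_isVEqualizer`). It
contains the variables, is closed under substitution (`ext_genComp_actThen`) and, by hypothesis,
receives the generators. Thus `E` is a relative monad on `j`. Because `j` is eleutheric, the left
Kan extension of a relative monad along `j` is a `J`-ary `V`-monad (`RelMonad.Kan.kleisli`,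
`RelMonad.Kan.isJAry`), here with a morphism `Φ` to `T_Σ` through which the unit of the free monad
factors. Freeness splits `Φ` (`FreeJMonad.exists_section`); the two comparison morphisms agree after
restriction along `Φ`, so they agree. Since `T_Σ` is `J`-ary, agreement at arities in `J` gives the
homomorphism condition (`IsJAry.actThen_eq`).

For the first claim, an algebra satisfies `E` exactly when its restrictions along the two induced
morphisms `T_Γ ⇉ T` have the same underlying `Γ`-algebra, hence, by injectivity, exactly when these
restrictions are equal (`satisfies_iff_restrict_eq`). So the full sub-`V`-category `(T, E)-Alg` maps
into the equalizer of the two restriction `V`-functors, which is `(T/E)-Alg` because the coequalizer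
is algebraic; conversely every `T/E`-algebra restricts to one that satisfies `E`.

For the second claim, `T_P-Alg` is `(T_Σ, E)-Alg` by the first, and this is carried isomorphically
onto `P-Alg` by the injective, fully faithful comparison, which reaches every `P`-algebra by
definition. -/

namespace JAry

noncomputable section

/-! ### Calculus of generalized elements of hom-objects. -/

section GeneralizedElements

variable {V : Type u} [Category.{v} V] [MonoidalCategory V]
variable {C : Type w} [EnrichedCategory V C]

/-- Composition (in diagrammatic order) of generalized elements of the hom-objects of a
`V`-category. -/
def genComp {P Q : V} {A B D : C} (x : P ⟶ (A ⟶[V] B)) (y : Q ⟶ (B ⟶[V] D)) :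
    P ⊗ Q ⟶ (A ⟶[V] D) :=
  (x ⊗ₘ y) ≫ eComp V A B D

/-- Composition of generalized elements of hom-objects, in diagrammatic order. -/
infixr:75 " ⊛ " => genComp

theorem id_genComp_id (A B D : C) : 𝟙 (A ⟶[V] B) ⊛ 𝟙 (B ⟶[V] D) = eComp V A B D := by
  simp [genComp]

theorem genComp_homPost {P Q : V} {A B D D' : C} (x : P ⟶ (A ⟶[V] B)) (y : Q ⟶ (B ⟶[V] D))
    (g : Mor V D D') : (x ⊛ y) ≫ homPost A g = x ⊛ y ≫ homPost B g := by
  simp only [genComp, Category.assoc, eComp_homPost, tensorHom_comp_whiskerLeft_assoc]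

theorem genComp_homPre {P Q : V} {A A' B D : C} (x : P ⟶ (A' ⟶[V] B)) (y : Q ⟶ (B ⟶[V] D))
    (f : Mor V A A') : (x ⊛ y) ≫ homPre f D = x ≫ homPre f B ⊛ y := by
  simp only [genComp, Category.assoc, eComp_homPre, tensorHom_comp_whiskerRight_assoc]

theorem homPost_genComp {P Q : V} {A B B' D : C} (x : P ⟶ (A ⟶[V] B)) (y : Q ⟶ (B' ⟶[V] D))
    (g : Mor V B B') : x ≫ homPost A g ⊛ y = x ⊛ y ≫ homPre g D := by
  simp only [genComp]
  rw [← tensorHom_comp_whiskerRight_assoc, homPost_eComp, tensorHom_comp_whiskerLeft_assoc]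

theorem comp_genComp {P P' Q : V} {A B D : C} (p : P' ⟶ P) (x : P ⟶ (A ⟶[V] B))
    (y : Q ⟶ (B ⟶[V] D)) : p ≫ x ⊛ y = p ▷ Q ≫ (x ⊛ y) := by
  rw [genComp, genComp, whiskerRight_comp_tensorHom_assoc]

theorem genComp_comp {P Q Q' : V} {A B D : C} (q : Q' ⟶ Q) (x : P ⟶ (A ⟶[V] B))
    (y : Q ⟶ (B ⟶[V] D)) : x ⊛ q ≫ y = P ◁ q ≫ (x ⊛ y) := by
  rw [genComp, genComp, whiskerLeft_comp_tensorHom_assoc]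

theorem tensorHom_genComp {P P' Q Q' : V} {A B D : C} (p : P' ⟶ P) (q : Q' ⟶ Q)
    (x : P ⟶ (A ⟶[V] B)) (y : Q ⟶ (B ⟶[V] D)) :
    (p ⊗ₘ q) ≫ (x ⊛ y) = (p ≫ x ⊛ q ≫ y) := by
  simp [genComp]

theorem whiskerRight_genComp {P P' Q : V} {A B D : C} (p : P' ⟶ P)
    (x : P ⟶ (A ⟶[V] B)) (y : Q ⟶ (B ⟶[V] D)) : p ▷ Q ≫ (x ⊛ y) = (p ≫ x ⊛ y) :=
  (comp_genComp _ _ _).symm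

theorem whiskerLeft_genComp {P Q Q' : V} {A B D : C} (q : Q' ⟶ Q)
    (x : P ⟶ (A ⟶[V] B)) (y : Q ⟶ (B ⟶[V] D)) : P ◁ q ≫ (x ⊛ y) = (x ⊛ q ≫ y) :=
  (genComp_comp _ _ _).symm

theorem genComp_assoc {P Q R : V} {A B D E : C} (x : P ⟶ (A ⟶[V] B)) (y : Q ⟶ (B ⟶[V] D))
    (z : R ⟶ (D ⟶[V] E)) : (x ⊛ y) ⊛ z = (α_ P Q R).hom ≫ (x ⊛ y ⊛ z) := by
  simp only [genComp]
  rw [← tensorHom_comp_whiskerRight, ← tensorHom_comp_whiskerLeft, Category.assoc, Category.assoc,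
    ← e_assoc', associator_naturality_assoc]

theorem genComp_assoc' {P Q R : V} {A B D E : C} (x : P ⟶ (A ⟶[V] B)) (y : Q ⟶ (B ⟶[V] D))
    (z : R ⟶ (D ⟶[V] E)) : (x ⊛ y ⊛ z) = (α_ P Q R).inv ≫ ((x ⊛ y) ⊛ z) := by
  rw [genComp_assoc, Iso.inv_hom_id_assoc]

theorem genComp_map {D : Type w₁} [EnrichedCategory V D] (F : EnrichedFunctor V C D) {P Q : V}
    {A B E : C} (x : P ⟶ (A ⟶[V] B)) (y : Q ⟶ (B ⟶[V] E)) :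
    (x ⊛ y) ≫ F.map A E = (x ≫ F.map A B ⊛ y ≫ F.map B E) := by
  simp [genComp]

theorem genComp_mor {P : V} {A B D : C} (x : P ⟶ (A ⟶[V] B)) (g : Mor V B D) :
    x ⊛ g = (ρ_ P).hom ≫ x ≫ homPost A g := by
  rw [genComp, homPost, MonoidalCategory.tensorHom_def, rightUnitor_inv_naturality_assoc]
  simp

theorem mor_genComp {P : V} {A B D : C} (f : Mor V A B) (y : P ⟶ (B ⟶[V] D)) :
    f ⊛ y = (λ_ P).hom ≫ y ≫ homPre f D := by
  rw [genComp, homPre, tensorHom_def', leftUnitor_inv_naturality_assoc]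
  simp

theorem genComp_homPost_assoc {P Q Z : V} {A B D D' : C} (x : P ⟶ (A ⟶[V] B))
    (y : Q ⟶ (B ⟶[V] D)) (g : Mor V D D') (h : (A ⟶[V] D') ⟶ Z) :
    (x ⊛ y) ≫ homPost A g ≫ h = (x ⊛ y ≫ homPost B g) ≫ h := by
  rw [← Category.assoc, genComp_homPost]

theorem genComp_map_assoc {D : Type w₁} [EnrichedCategory V D] (F : EnrichedFunctor V C D)
    {P Q Z : V} {A B E : C} (x : P ⟶ (A ⟶[V] B)) (y : Q ⟶ (B ⟶[V] E))
    (h : (F.obj A ⟶[V] F.obj E) ⟶ Z) :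
    (x ⊛ y) ≫ F.map A E ≫ h = (x ≫ F.map A B ⊛ y ≫ F.map B E) ≫ h := by
  rw [← Category.assoc, genComp_map]

theorem whiskerRight_genComp_assoc {P P' Q Z : V} {A B D : C} (p : P' ⟶ P)
    (x : P ⟶ (A ⟶[V] B)) (y : Q ⟶ (B ⟶[V] D)) (h : (A ⟶[V] D) ⟶ Z) :
    p ▷ Q ≫ (x ⊛ y) ≫ h = (p ≫ x ⊛ y) ≫ h := by
  rw [← Category.assoc, whiskerRight_genComp]

theorem homPost_eq_of_genComp_eq {P : V} {A B D : C} {x : P ⟶ (A ⟶[V] B)} {g : Mor V B D}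
    {y : P ⟶ (A ⟶[V] D)} (h : x ⊛ g = (ρ_ P).hom ≫ y) : x ≫ homPost A g = y := by
  rw [genComp_mor] at h
  exact (cancel_epi _).1 h

end GeneralizedElements

/-! ### `V`-monads in extension form. -/

section Kleisli

variable (V : Type u) [Category.{v} V] [MonoidalCategory V]
variable (C : Type w) [EnrichedCategory V C]

/-- A `V`-monad in extension form. -/
structure KleisliTriple where
  /-- the action on objects -/
  obj : C → C
  /-- the unit -/
  η (A : C) : Mor V A (obj A)
  /-- the extension operation -/
  ext (A B : C) : (A ⟶[V] obj B) ⟶ (obj A ⟶[V] obj B)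
  ext_η (A B : C) : ext A B ≫ homPre (η A) (obj B) = 𝟙 _
  η_ext (A : C) : η A ≫ ext A A = eId V (obj A)
  ext_ext (A B D : C) : (𝟙 (A ⟶[V] obj B) ⊛ ext B D) ≫ ext A D = ext A B ⊛ ext B D

namespace KleisliTriple

variable {V C} (K : KleisliTriple V C)

theorem genComp_ext {P Q : V} {A B D : C} (x : P ⟶ (A ⟶[V] K.obj B)) (y : Q ⟶ (B ⟶[V] K.obj D)) :
    (x ⊛ y ≫ K.ext B D) ≫ K.ext A D = (x ≫ K.ext A B ⊛ y ≫ K.ext B D) := by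
  rw [← tensorHom_genComp x y (K.ext A B), ← K.ext_ext, ← Category.assoc, tensorHom_genComp,
    Category.comp_id]

/-- The extension law with its second variable specialized to the global element `k`; in
`ext_homPre` it is the first variable that is specialized. -/
theorem homPost_ext (A : C) {B D : C} (k : Mor V B (K.obj D)) :
    homPost A (k ≫ K.ext B D) ≫ K.ext A D = K.ext A B ≫ homPost (K.obj A) (k ≫ K.ext B D) := by
  have h := K.genComp_ext (𝟙 (A ⟶[V] K.obj B)) k
  simpa [genComp_mor] using h

theorem ext_homPre {A B : C} (D : C) (k : Mor V A (K.obj B)) :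
    K.ext B D ≫ homPre k (K.obj D) ≫ K.ext A D =
      K.ext B D ≫ homPre (k ≫ K.ext A B) (K.obj D) := by
  have h := K.genComp_ext k (𝟙 (B ⟶[V] K.obj D))
  simpa [mor_genComp] using h

/-- The action on hom-objects of the `V`-endofunctor of a Kleisli triple. -/
def map (A B : C) : (A ⟶[V] B) ⟶ (K.obj A ⟶[V] K.obj B) :=
  homPost A (K.η B) ≫ K.ext A B

/-- The multiplication of the `V`-monad of a Kleisli triple. -/
def μ (A : C) : Mor V (K.obj (K.obj A)) (K.obj A) := eId V (K.obj A) ≫ K.ext (K.obj A) A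

theorem map_homPre_η (A B : C) : K.map A B ≫ homPre (K.η A) (K.obj B) = homPost A (K.η B) := by
  rw [map, Category.assoc, K.ext_η, Category.comp_id]

theorem eId_map (A : C) : eId V A ≫ K.map A A = eId V (K.obj A) := by
  rw [map, ← Category.assoc, ← Mor.comp_eq_post, Mor.id_comp, K.η_ext]

/-- A composite of `f` and `g` is sent to the extension of `η ∘ g ∘ f`. Since `η ∘ g = K g ∘ η`,
this is the extension of `K g ∘ (η ∘ f)` with `K g` itself an extension, which is the form handled
by `genComp_ext`. -/
theorem eComp_map (A B D : C) : eComp V A B D ≫ K.map A D = K.map A B ⊛ K.map B D := by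
  rw [← id_genComp_id, map, ← Category.assoc, genComp_homPost, Category.id_comp, ← map_homPre_η,
    ← homPost_genComp, map, K.genComp_ext, Category.id_comp, map]

theorem η_μ (A : C) : K.η (K.obj A) ⋄ K.μ A = eId V (K.obj A) := by
  rw [Mor.comp_eq_pre, μ, Category.assoc, K.ext_η, Category.comp_id]

theorem map_homPost_μ (A B : C) :
    K.map A (K.obj B) ≫ homPost (K.obj A) (K.μ B) = K.ext A B := by
  rw [map, μ, Category.assoc, ← K.homPost_ext, ← μ, ← Category.assoc, ← homPost_comp, η_μ,
    homPost_id, Category.id_comp]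

theorem map_homPre_μ (A B : C) :
    K.map A B ≫ homPre (K.μ A) (K.obj B) = K.map A B ≫ K.map (K.obj A) (K.obj B) ≫
      homPost (K.obj (K.obj A)) (K.μ B) := by
  rw [map_homPost_μ, map, Category.assoc, Category.assoc, μ, ← K.ext_homPre, homPre_id,
    Category.id_comp]

theorem μ_ext (A : C) : K.μ A ≫ K.ext (K.obj (K.obj A)) A = K.μ (K.obj A) ⋄ K.μ A := by
  rw [Mor.comp_eq_post, μ, μ, Category.assoc, Category.assoc, ← K.homPost_ext,
    ← Category.assoc (eId _ _) (homPost _ _), ← Mor.comp_eq_post, Mor.id_comp, Category.assoc]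

/-- The `V`-endofunctor of a Kleisli triple. -/
@[reducible]
def functor : EnrichedFunctor V C C where
  obj := K.obj
  map := K.map
  map_id := K.eId_map
  map_comp := K.eComp_map

theorem mapMor_μ {A B : C} (f : Mor V A (K.obj B)) :
    mapMor K.functor f ⋄ K.μ B = f ≫ K.ext A B := by
  rw [Mor.comp_eq_post, mapMor, Category.assoc, map_homPost_μ]

/-- The `V`-monad of a Kleisli triple. -/
@[reducible]
def toVMonad : VMonad V C where
  T := K.functor
  η := K.η
  μ := K.μ
  η_naturality A B := (K.map_homPre_η A B).symm
  μ_naturality A B := (K.map_homPre_μ A B).symm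
  left_unit := K.η_μ
  right_unit A := by rw [mapMor_μ, K.η_ext]
  assoc A := (K.mapMor_μ (K.μ A)).trans (K.μ_ext A)

section

variable {K} {T : VMonad V C} {φ : ∀ A, Mor V (K.obj A) (T.T.obj A)}

/-- Naturality is not an extra condition: `K.map` is `ext` after composition with the unit, `φ`
carries the unit to that of `T`, and the right unit law of `T` cancels what is left. -/
theorem map_homPost_of_ext (unit : ∀ A, K.η A ⋄ φ A = T.η A)
    (ext : ∀ A B, K.ext A B ≫ homPost (K.obj A) (φ B) =
      homPost A (φ B) ≫ T.T.map A (T.T.obj B) ≫ homPost (T.T.obj A) (T.μ B) ≫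
        homPre (φ A) (T.T.obj B)) (A B : C) :
    K.map A B ≫ homPost (K.obj A) (φ B) = T.T.map A B ≫ homPre (φ A) (T.T.obj B) := by
  rw [map, Category.assoc, ext, ← Category.assoc, ← homPost_comp, unit, ← Category.assoc,
    homPost_map, Category.assoc, ← Category.assoc (homPost _ _), ← homPost_comp, T.right_unit]
  simp

theorem μ_comp_of_ext (ext : ∀ A B, K.ext A B ≫ homPost (K.obj A) (φ B) =
      homPost A (φ B) ≫ T.T.map A (T.T.obj B) ≫ homPost (T.T.obj A) (T.μ B) ≫
        homPre (φ A) (T.T.obj B)) (A : C) :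
    K.μ A ⋄ φ A = φ (K.obj A) ⋄ mapMor T.T (φ A) ⋄ T.μ A := by
  rw [Mor.comp_eq_post, μ, Category.assoc, ext, ← Category.assoc, ← Mor.comp_eq_post, Mor.id_comp,
    Mor.comp_eq_pre, Mor.comp_eq_post, mapMor]
  simp

variable (K T φ) in
/-- A morphism of `V`-monads out of the `V`-monad of a Kleisli triple. -/
@[reducible]
def homOf (unit : ∀ A, K.η A ⋄ φ A = T.η A)
    (ext : ∀ A B, K.ext A B ≫ homPost (K.obj A) (φ B) =
      homPost A (φ B) ≫ T.T.map A (T.T.obj B) ≫ homPost (T.T.obj A) (T.μ B) ≫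
        homPre (φ A) (T.T.obj B)) : VMonad.Hom K.toVMonad T where
  trans := ⟨φ, map_homPost_of_ext unit ext⟩
  unit := unit
  mult := μ_comp_of_ext ext

end

end KleisliTriple

end Kleisli

/-! ### Colimits weighted by `C(j-, A)`, and what eleutheric means for them. -/

section RepresentableWeights

variable {V : Type u} [Category.{v} V] [MonoidalCategory V]
variable {C : Type w} [EnrichedCategory V C] {J : Type w₁} [EnrichedCategory V J]
variable {E : Type w₂} [EnrichedCategory V E]

/-- `V`-naturality in `b` of a family `C(j b, A) ⊗ Z ⟶ E(D b, X)`. -/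
def IsRepNatural (j : EnrichedFunctor V J C) (A : C) (D : EnrichedFunctor V J E) {Z : V} {X : E}
    (f : ∀ b, (j.obj b ⟶[V] A) ⊗ Z ⟶ (D.obj b ⟶[V] X)) : Prop :=
  ∀ a b : J, (D.map a b ⊛ f b) = (α_ _ _ _).inv ≫ (j.map a b ⊛ 𝟙 (j.obj b ⟶[V] A)) ▷ Z ≫ f a

/-- The family `C(j b, A) ⟶ E(D b, K)` exhibits `K` as the colimit of `D` weighted by `C(j-, A)`;
compared with `Cylinder.IsColimit`, this does not involve a closed structure on `V`. -/
structure IsRepColimit (j : EnrichedFunctor V J C) {A : C} (D : EnrichedFunctor V J E) {K : E}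
    (l : ∀ b, (j.obj b ⟶[V] A) ⟶ (D.obj b ⟶[V] K)) : Prop where
  nat (a b : J) : (D.map a b ⊛ l b) = (j.map a b ⊛ 𝟙 (j.obj b ⟶[V] A)) ≫ l a
  exists_desc {Z : V} {X : E} (f : ∀ b, (j.obj b ⟶[V] A) ⊗ Z ⟶ (D.obj b ⟶[V] X))
    (hf : IsRepNatural j A D f) : ∃ g : Z ⟶ (K ⟶[V] X), ∀ b, (l b ⊛ g) = f b
  hom_ext {Z : V} {X : E} {g h : Z ⟶ (K ⟶[V] X)} (e : ∀ b, (l b ⊛ g) = (l b ⊛ h)) : g = h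

namespace IsRepColimit

variable {j : EnrichedFunctor V J C} {A : C} {D : EnrichedFunctor V J E} {K : E}
  {l : ∀ b, (j.obj b ⟶[V] A) ⟶ (D.obj b ⟶[V] K)} (h : IsRepColimit j D l)

include h

theorem exists_mor {X : E} (f : ∀ b, (j.obj b ⟶[V] A) ⟶ (D.obj b ⟶[V] X))
    (hf : ∀ a b : J, (D.map a b ⊛ f b) = (j.map a b ⊛ 𝟙 (j.obj b ⟶[V] A)) ≫ f a) :
    ∃ g : Mor V K X, ∀ b, l b ≫ homPost (D.obj b) g = f b := by
  obtain ⟨g, hg⟩ := h.exists_desc (fun b => (ρ_ _).hom ≫ f b) fun a b => by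
    rw [genComp_comp, hf]
    simp
  refine ⟨g, fun b => ?_⟩
  have := hg b
  rw [genComp_mor] at this
  exact (cancel_epi _).1 this

theorem mor_ext {X : E} {g g' : Mor V K X}
    (e : ∀ b, l b ≫ homPost (D.obj b) g = l b ≫ homPost (D.obj b) g') : g = g' :=
  h.hom_ext fun b => by rw [genComp_mor, genComp_mor, e]

end IsRepColimit

end RepresentableWeights

section HomFunctor

variable {V : Type u} [Category.{v} V] [MonoidalCategory V] [MonoidalClosed V]
variable {C : Type w} [EnrichedCategory V C]

/-- Translates composition in `V` into uncurried form, so that preservation of a colimit by `C(X,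
-)` can be used without internal homs. -/
theorem homFunctor_map_genComp_curry {B D X : C} {P Q W : V} (x : P ⟶ (B ⟶[V] D))
    (y : (X ⟶[V] D) ⊗ Q ⟶ W) :
    ((x ≫ (homFunctor (V := V) X).map B D) ⊛
      (MonoidalClosed.curry y : Q ⟶ EnrichedCategory.Hom (C := V) (X ⟶[V] D) W)) =
      MonoidalClosed.curry ((α_ _ _ _).inv ≫ (𝟙 (X ⟶[V] B) ⊛ x) ▷ Q ≫ y) := by
  have h : x ≫ (homFunctor (V := V) X).map B D =
      MonoidalClosed.curry (𝟙 (X ⟶[V] B) ⊛ x) := by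
    rw [genComp, id_tensorHom, MonoidalClosed.curry_natural_left]
    rfl
  rw [h, ← ev_ev, genComp, MonoidalClosed.curry_natural_left]
  rfl

end HomFunctor

section Cylinders

variable {V : Type u} [Category.{v} V] [MonoidalCategory V] [MonoidalClosed V]
  [SymmetricCategory V]
variable {C : Type w} [EnrichedCategory V C] {J : Type w₁} [EnrichedCategory V J]
variable {E : Type w₂} [EnrichedCategory V E]
variable {j : EnrichedFunctor V J C} {A : C} {D : EnrichedFunctor V J E}

theorem isVNatural_repWeight_iff {Z : V} {X : E}
    (f : ∀ b, (j.obj b ⟶[V] A) ⊗ Z ⟶ (D.obj b ⟶[V] X)) :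
    IsVNatural (repWeight j A) D Z X f ↔ IsRepNatural j A D f := by
  refine forall_congr' fun a => forall_congr' fun b => ?_
  rw [weightAct_repWeight]
  have h : (j.map a b ⊛ 𝟙 (j.obj b ⟶[V] A)) = j.map a b ▷ _ ≫ eComp V (j.obj a) (j.obj b) A := by
    rw [genComp, tensorHom_id]
  rw [h]
  rfl

theorem Cylinder.repWeight_nat {K : E} (l : Cylinder (repWeight j A) D K) (a b : J) :
    (D.map a b ⊛ l.app b) = (j.map a b ⊛ 𝟙 (j.obj b ⟶[V] A)) ≫ l.app a := by
  have h := l.naturality a b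
  rw [weightAct_repWeight] at h
  rw [genComp, genComp, tensorHom_id]
  exact h

/-- The cylinder for a representable weight given by a natural family. -/
def repCylinder {K : E} (l : ∀ b, (j.obj b ⟶[V] A) ⟶ (D.obj b ⟶[V] K))
    (hl : ∀ a b : J, (D.map a b ⊛ l b) = (j.map a b ⊛ 𝟙 (j.obj b ⟶[V] A)) ≫ l a) :
    Cylinder (repWeight j A) D K where
  app := l
  naturality a b := by
    have h := hl a b
    rw [weightAct_repWeight]
    rw [genComp, genComp, tensorHom_id] at h
    exact h

theorem Cylinder.isRepColimit {K : E} {l : Cylinder (repWeight j A) D K} (hl : l.IsColimit) :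
    IsRepColimit j D (A := A) l.app where
  nat := l.repWeight_nat
  exists_desc f hf := (hl _ _ f ((isVNatural_repWeight_iff f).2 hf)).exists
  hom_ext {Z X g h} e := by
    -- Both `g` and `h` induce the family `l b ⊛ h`, which is natural because the cylinder is.
    refine (hl X Z (fun b => (l.app b ⊛ h)) ((isVNatural_repWeight_iff _).2 fun a b => ?_)).unique
      e (fun _ => rfl)
    refine (genComp_assoc' (D.map a b) (l.app b) h).trans ?_
    rw [l.repWeight_nat]
    exact congrArg (fun t => (α_ _ _ _).inv ≫ t) (comp_genComp _ (l.app a) h)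

theorem IsRepColimit.cylinder_isColimit {K : E} {l : ∀ b, (j.obj b ⟶[V] A) ⟶ (D.obj b ⟶[V] K)}
    (h : IsRepColimit j D l) : (repCylinder l h.nat).IsColimit := fun X Z f hf => by
  obtain ⟨g, hg⟩ := h.exists_desc f ((isVNatural_repWeight_iff f).1 hf)
  exact ⟨g, hg, fun g' hg' => h.hom_ext fun b => (hg' b).trans (hg b).symm⟩

theorem IsDense.isRepColimit {j : EnrichedFunctor V J C} (hj : IsDense j) (A : C) :
    IsRepColimit j j (fun b => 𝟙 (j.obj b ⟶[V] A)) :=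
  Cylinder.isRepColimit (hj A)

theorem IsJAry.isRepColimit {C' : Type w₃} [EnrichedCategory V C'] {H : EnrichedFunctor V C C'}
    (hH : IsJAry j H) {D : EnrichedFunctor V J C}
    {K : C} {l : ∀ b, (j.obj b ⟶[V] A) ⟶ (D.obj b ⟶[V] K)} (h : IsRepColimit j D l) :
    IsRepColimit j (D.comp V H) (fun b => l b ≫ H.map (D.obj b) K) :=
  Cylinder.isRepColimit (hH A D K _ h.cylinder_isColimit)

theorem isJAry_of_isRepColimit {C' : Type w₃} [EnrichedCategory V C'] {H : EnrichedFunctor V C C'}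
    (hH : ∀ (A : C) (D : EnrichedFunctor V J C) (K : C)
      (l : ∀ b, (j.obj b ⟶[V] A) ⟶ (D.obj b ⟶[V] K)), IsRepColimit j D l →
      IsRepColimit j (D.comp V H) (fun b => l b ≫ H.map (D.obj b) K)) : IsJAry j H :=
  fun A D K _ hl => (hH A D K _ (Cylinder.isRepColimit hl)).cylinder_isColimit

theorem IsEleutheric.exists_isRepColimit {j : EnrichedFunctor V J C} (he : IsEleutheric j) (A : C)
    (D : EnrichedFunctor V J C) :
    ∃ (K : C) (l : ∀ b, (j.obj b ⟶[V] A) ⟶ (D.obj b ⟶[V] K)), IsRepColimit j D l := by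
  obtain ⟨K, l, hl⟩ := he.hasColimit A D
  exact ⟨K, l.app, Cylinder.isRepColimit hl⟩

section HomFunctor

variable {D : EnrichedFunctor V J C} {K : C} {l : ∀ b, (j.obj b ⟶[V] A) ⟶ (D.obj b ⟶[V] K)}

/-- `C(j a, -)` preserves the colimit `K`, so `C(j a, K)` is the colimit in `V` of the objects `C(j
a, D b)`, and a morphism out of `C(j a, K) ⊗ Z` may be defined on pairs `j a ⟶ D b`, `j b ⟶ A`. -/
theorem IsEleutheric.exists_desc_hom (he : IsEleutheric j) (h : IsRepColimit j D l) (a : J)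
    {Z X : V}
    (f : ∀ b, (j.obj a ⟶[V] D.obj b) ⊗ ((j.obj b ⟶[V] A) ⊗ Z) ⟶ X)
    (hf : ∀ b c, (α_ _ _ _).inv ≫ (𝟙 (j.obj a ⟶[V] D.obj b) ⊛ D.map b c) ▷ _ ≫ f c =
      _ ◁ ((α_ _ _ _).inv ≫ (j.map b c ⊛ 𝟙 (j.obj c ⟶[V] A)) ▷ Z) ≫ f b) :
    ∃ g : (j.obj a ⟶[V] K) ⊗ Z ⟶ X,
      ∀ b, (α_ _ _ _).inv ≫ (𝟙 (j.obj a ⟶[V] D.obj b) ⊛ l b) ▷ Z ≫ g = f b := by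
  have h1 := IsJAry.isRepColimit (H := homFunctor (V := V) (j.obj a)) (he.preserves a) h
  obtain ⟨g, hg⟩ := h1.exists_desc (X := X) (fun b => MonoidalClosed.curry (f b)) fun b c => by
    refine (homFunctor_map_genComp_curry (D.map b c) (f c)).trans ?_
    rw [hf, MonoidalClosed.curry_natural_left, Category.assoc]
    rfl
  obtain ⟨g, rfl⟩ : ∃ g' : (j.obj a ⟶[V] K) ⊗ Z ⟶ X, g = MonoidalClosed.curry g' :=
    ⟨MonoidalClosed.uncurry g, (MonoidalClosed.curry_uncurry g).symm⟩
  refine ⟨g, fun b => ?_⟩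
  apply MonoidalClosed.curry_injective
  rw [← homFunctor_map_genComp_curry]
  exact hg b

theorem IsEleutheric.hom_ext_hom (he : IsEleutheric j) (h : IsRepColimit j D l) (a : J) {Z X : V}
    {g g' : (j.obj a ⟶[V] K) ⊗ Z ⟶ X}
    (e : ∀ b, (𝟙 (j.obj a ⟶[V] D.obj b) ⊛ l b) ▷ Z ≫ g =
      (𝟙 (j.obj a ⟶[V] D.obj b) ⊛ l b) ▷ Z ≫ g') : g = g' := by
  have h1 := IsJAry.isRepColimit (H := homFunctor (V := V) (j.obj a)) (he.preserves a) h
  apply MonoidalClosed.curry_injective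
  refine h1.hom_ext (X := X) (fun b => ?_)
  refine (homFunctor_map_genComp_curry (l b) g).trans ?_
  rw [e]
  exact (homFunctor_map_genComp_curry (l b) g').symm

theorem IsEleutheric.mor_ext_hom (he : IsEleutheric j) (h : IsRepColimit j D l) (a : J) {X : V}
    {g g' : (j.obj a ⟶[V] K) ⟶ X}
    (e : ∀ b, (𝟙 (j.obj a ⟶[V] D.obj b) ⊛ l b) ≫ g =
      (𝟙 (j.obj a ⟶[V] D.obj b) ⊛ l b) ≫ g') : g = g' := by
  rw [← cancel_epi (ρ_ _).hom]
  refine he.hom_ext_hom h a fun b => ?_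
  rw [rightUnitor_naturality_assoc, rightUnitor_naturality_assoc, e]

theorem IsEleutheric.exists_mor_hom (he : IsEleutheric j) (h : IsRepColimit j D l) (a : J) {X : V}
    (f : ∀ b, (j.obj a ⟶[V] D.obj b) ⊗ (j.obj b ⟶[V] A) ⟶ X)
    (hf : ∀ b c, (α_ _ _ _).inv ≫ (𝟙 (j.obj a ⟶[V] D.obj b) ⊛ D.map b c) ▷ _ ≫ f c =
      _ ◁ (j.map b c ⊛ 𝟙 (j.obj c ⟶[V] A)) ≫ f b) :
    ∃ g : (j.obj a ⟶[V] K) ⟶ X,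
      ∀ b, (𝟙 (j.obj a ⟶[V] D.obj b) ⊛ l b) ≫ g = f b := by
  obtain ⟨g, hg⟩ := he.exists_desc_hom h a (fun b => _ ◁ (ρ_ _).hom ≫ f b) fun b c => by
    rw [← whisker_exchange_assoc, ← associator_inv_naturality_right_assoc, hf]
    simp only [← MonoidalCategory.whiskerLeft_comp_assoc, Category.assoc]
    simp
  refine ⟨(ρ_ _).inv ≫ g, fun b => ?_⟩
  rw [rightUnitor_inv_naturality_assoc, ← cancel_epi (_ ◁ (ρ_ _).hom), ← hg b]
  simp

end HomFunctor

end Cylinders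

/-! ### Enriched equalizers in `C`. -/

section Braided

variable {V : Type u} [Category.{v} V] [MonoidalCategory V] [BraidedCategory V]
variable {C : Type w} [EnrichedCategory V C] {J : Type w₁} [EnrichedCategory V J]

/-- The action on `W` is restricted from `C(j-, P)` along the monomorphisms `i a`, so it inherits
the unit law, and in `actOf_comp` the composition law. -/
theorem actOf_id {j : EnrichedFunctor V J C} {P : C} {W : J → V}
    {i : ∀ a, W a ⟶ (j.obj a ⟶[V] P)} (hi : ∀ a, Mono (i a))
    {m : ∀ a b : J, (a ⟶[V] b) ⊗ W b ⟶ W a} (hm : ∀ a b, m a b ≫ i a = (j.map a b ⊛ i b)) (a : J) :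
    W a ◁ eId V a ≫ (β_ _ _).hom ≫ m a a = (ρ_ (W a)).hom := by
  rw [← cancel_mono (i a)]
  simp only [Category.assoc]
  rw [hm, BraidedCategory.braiding_naturality_right_assoc, whiskerRight_genComp, j.map_id,
    mor_genComp]
  simp

theorem actOf_comp {j : EnrichedFunctor V J C} {P : C} {W : J → V}
    {i : ∀ a, W a ⟶ (j.obj a ⟶[V] P)} (hi : ∀ a, Mono (i a))
    {m : ∀ a b : J, (a ⟶[V] b) ⊗ W b ⟶ W a} (hm : ∀ a b, m a b ≫ i a = (j.map a b ⊛ i b))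
    (x y z : J) :
    W x ◁ ((β_ (y ⟶[V] x) (z ⟶[V] y)).hom ≫ eComp V z y x) ≫ (β_ (W x) (z ⟶[V] x)).hom ≫ m z x =
      (α_ _ _ _).inv ≫ ((β_ (W x) (y ⟶[V] x)).hom ≫ m y x) ▷ (z ⟶[V] y) ≫
        (β_ (W y) (z ⟶[V] y)).hom ≫ m z y := by
  have key := i x ▷ _ ≫= repWeight_aux j P x y z
  have hm' : ∀ a b, m a b ≫ i a = _ ◁ i b ≫ j.map a b ▷ _ ≫ eComp V (j.obj a) (j.obj b) P := by
    intro a b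
    rw [hm, genComp, tensorHom_def', Category.assoc]
  rw [← cancel_mono (i z)]
  simp only [Category.assoc, hm']
  rw [← BraidedCategory.braiding_naturality_left_assoc, whisker_exchange_assoc, key,
    ← BraidedCategory.braiding_naturality_left_assoc, ← comp_whiskerRight_assoc]
  simp only [Category.assoc, hm']
  rw [← BraidedCategory.braiding_naturality_left_assoc, associator_inv_naturality_left_assoc]
  simp only [comp_whiskerRight, Category.assoc]

end Braided

section Equalizers

variable {V : Type u} [Category.{v} V] [MonoidalCategory V] [MonoidalClosed V]
  [SymmetricCategory V]
variable {C : Type w} [EnrichedCategory V C] {J : Type w₁} [EnrichedCategory V J]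

/-- `k` exhibits `K` as the equalizer in the `V`-enriched sense of `p` and `q`. -/
structure IsVEqualizer {K P Q : C} (k : Mor V K P) (p q : Mor V P Q) : Prop where
  condition : k ⋄ p = k ⋄ q
  exists_lift {X : C} {Z : V} (g : Z ⟶ (X ⟶[V] P)) (hg : g ≫ homPost X p = g ≫ homPost X q) :
    ∃ h : Z ⟶ (X ⟶[V] K), h ≫ homPost X k = g
  mono (X : C) : Mono (homPost X k)

/-- The weight given by a family of subobjects of `C(j a, P)` closed under the action of `J`. -/
def subWeight {j : EnrichedFunctor V J C} {P : C} {W : J → V}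
    {i : ∀ a, W a ⟶ (j.obj a ⟶[V] P)} (hi : ∀ a, Mono (i a))
    {m : ∀ a b : J, (a ⟶[V] b) ⊗ W b ⟶ W a} (hm : ∀ a b, m a b ≫ i a = (j.map a b ⊛ i b)) :
    EnrichedFunctor V Jᵒᵖ V :=
  vFunctorOfAct (fun X => W X.unop) (fun X Y => (β_ _ _).hom ≫ m Y.unop X.unop)
    (fun X => actOf_id hi hm X.unop) (fun X Y Z => actOf_comp hi hm X.unop Y.unop Z.unop)

theorem weightAct_subWeight {j : EnrichedFunctor V J C} {P : C} {W : J → V}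
    {i : ∀ a, W a ⟶ (j.obj a ⟶[V] P)} (hi : ∀ a, Mono (i a))
    {m : ∀ a b : J, (a ⟶[V] b) ⊗ W b ⟶ W a} (hm : ∀ a b, m a b ≫ i a = (j.map a b ⊛ i b))
    (a b : J) :
    weightAct (subWeight hi hm) a b = m a b :=
  (congrArg (fun t => (β_ (a ⟶[V] b) (W b)).hom ≫ t)
    (MonoidalClosed.uncurry_curry _)).trans (SymmetricCategory.symmetry_assoc _ _ _)

end Equalizers

section

variable {V : Type u} [Category.{v} V] [MonoidalCategory V] [MonoidalClosed V]
  [SymmetricCategory V]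
variable {C : Type w} [EnrichedCategory V C] {J : Type v} [EnrichedCategory V J]

/-- The colimit weighted by a family of subobjects, in terms of the action of `J` only. -/
theorem IsCocomplete.exists_colimit (hC : IsCocomplete V C) {j : EnrichedFunctor V J C} {P : C}
    {W : J → V} {i : ∀ a, W a ⟶ (j.obj a ⟶[V] P)} (hi : ∀ a, Mono (i a))
    {m : ∀ a b : J, (a ⟶[V] b) ⊗ W b ⟶ W a} (hm : ∀ a b, m a b ≫ i a = (j.map a b ⊛ i b)) :
    ∃ (K : C) (l : ∀ a, W a ⟶ (j.obj a ⟶[V] K)),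
      (∀ a b, (j.map a b ⊛ l b) = m a b ≫ l a) ∧
      ∀ (X : C) (f : ∀ a, W a ⟶ (j.obj a ⟶[V] X)), (∀ a b, (j.map a b ⊛ f b) = m a b ≫ f a) →
        ∃! g : Mor V K X, ∀ a, l a ≫ homPost (j.obj a) g = f a := by
  obtain ⟨K, l, hl⟩ := hC J (subWeight hi hm) j
  have hn : ∀ a b, (j.map a b ⊛ l.app b) = m a b ≫ l.app a := fun a b => by
    have h := l.naturality a b
    rw [weightAct_subWeight] at h
    exact h
  refine ⟨K, l.app, hn, fun X f hf => ?_⟩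
  -- Only the test object `𝟙_ V` is used here: density later upgrades the ordinary universal
  -- property to the enriched one.
  have key : ∀ (a : J) (g : Mor V K X),
      ((l.app a ⊗ₘ g) ≫ eComp V (j.obj a) K X = (ρ_ _).hom ≫ f a) ↔
        l.app a ≫ homPost (j.obj a) g = f a := fun a g => by
    refine Iff.trans (Eq.congr_left (genComp_mor (l.app a) g)) ?_
    exact cancel_epi _
  refine (existsUnique_congr fun g => forall_congr' fun a => key a g).1
    (hl X (𝟙_ V) (fun a => (ρ_ _).hom ≫ f a) fun a b => ?_)
  rw [weightAct_subWeight]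
  refine (genComp_comp (ρ_ _).hom (j.map a b) (f b)).trans ?_
  have e : _ ◁ (ρ_ (W b)).hom ≫ m a b ≫ f a =
      (α_ _ _ _).inv ≫ m a b ▷ 𝟙_ V ≫ (ρ_ (W a)).hom ≫ f a := by
    rw [rightUnitor_naturality_assoc]
    simp
  rw [hf]
  exact e

/-- By density, `C` embeds fully in the presheaves on `J`, where the equalizer of `C(j-, p)` and
`C(j-, q)` is computed pointwise as a weight `W`. The colimit `K` of `j` weighted by `W` represents
`W`: the cylinder `l : W ⟶ C(j-, K)` has as inverse the factorization `r` of `C(j-, k)` through `W`.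
-/
theorem IsDense.exists_isVEqualizer [HasEqualizers V] {j : EnrichedFunctor V J C} (hj : IsDense j)
    (hC : IsCocomplete V C) {P Q : C} (p q : Mor V P Q) :
    ∃ (K : C) (k : Mor V K P), IsVEqualizer k p q := by
  let W : J → V := fun a => equalizer (homPost (j.obj a) p) (homPost (j.obj a) q)
  let i : ∀ a, W a ⟶ (j.obj a ⟶[V] P) := fun a => equalizer.ι _ _
  have hi : ∀ a, Mono (i a) := fun a => inferInstanceAs (Mono (equalizer.ι _ _))
  have ic : ∀ a, i a ≫ homPost (j.obj a) p = i a ≫ homPost (j.obj a) q :=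
    fun a => equalizer.condition _ _
  have ilift : ∀ (a : J) (Z : V) (g : Z ⟶ (j.obj a ⟶[V] P)),
      g ≫ homPost (j.obj a) p = g ≫ homPost (j.obj a) q → ∃ h : Z ⟶ W a, h ≫ i a = g :=
    fun a Z g hg => ⟨equalizer.lift g hg, equalizer.lift_ι _ _⟩
  clear_value i
  have hex : ∀ a b : J, ∃ m : (a ⟶[V] b) ⊗ W b ⟶ W a, m ≫ i a = (j.map a b ⊛ i b) := fun a b =>
    ilift a _ _ (by rw [genComp_homPost, genComp_homPost, ic])
  choose m hm using hex
  obtain ⟨K, l, hl, hu⟩ := hC.exists_colimit hi hm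
  have hext : ∀ {X : C} {g g' : Mor V K X}, (∀ a, l a ≫ homPost (j.obj a) g =
      l a ≫ homPost (j.obj a) g') → g = g' := fun {X g g'} e =>
    (hu X (fun a => l a ≫ homPost (j.obj a) g') (fun a b => by
      rw [← genComp_homPost, hl, Category.assoc])).unique e fun _ => rfl
  obtain ⟨k, hk⟩ := (hu P i fun a b => (hm a b).symm).exists
  have hkpq : k ⋄ p = k ⋄ q := hext fun a => by
    rw [homPost_comp, homPost_comp, reassoc_of% hk, reassoc_of% hk, ic]
  have hr : ∀ a, ∃ r : (j.obj a ⟶[V] K) ⟶ W a, r ≫ i a = homPost (j.obj a) k := fun a =>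
    ilift a _ _ (by rw [← homPost_comp, ← homPost_comp, hkpq])
  choose r hr using hr
  have hlr : ∀ a, l a ≫ r a = 𝟙 _ := fun a => by
    have := hi a
    rw [← cancel_mono (i a), Category.assoc, hr, hk, Category.id_comp]
  have hrm : ∀ a b, _ ◁ r b ≫ m a b = (j.map a b ⊛ 𝟙 _) ≫ r a := fun a b => by
    have := hi a
    rw [← cancel_mono (i a), Category.assoc, Category.assoc, hm, hr, genComp_homPost,
      whiskerLeft_genComp, hr, Category.id_comp]
  -- The natural family `r ≫ l` is induced by some `e : K ⟶ K`, by density. As `l ≫ r` is the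
  -- identity, `e` fixes the cylinder `l` and so is the identity.
  have hrl : ∀ a, r a ≫ l a = 𝟙 _ := by
    obtain ⟨e, he⟩ := (hj.isRepColimit K).exists_mor (fun b => r b ≫ l b) fun a b => by
      rw [genComp_comp, hl, reassoc_of% hrm]
    simp only [Category.id_comp] at he
    have : e = eId V K := hext fun a => by
      rw [he, reassoc_of% hlr, homPost_id, Category.comp_id]
    intro a
    rw [← he, this, homPost_id]
  have hmono : ∀ a, Mono (homPost (j.obj a) k) := fun a => by
    have := hi a
    have : Mono (r a) := ⟨fun g h e => by
      rw [← Category.comp_id g, ← Category.comp_id h, ← hrl, reassoc_of% e]⟩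
    rw [← hr]
    exact mono_comp _ _
  refine ⟨K, k, hkpq, fun {X Z} g hg => ?_, fun X => ⟨fun {Z} g h e => ?_⟩⟩
  -- Lift `g` after composition with each `j b ⟶ X`, then glue the lifts along the canonical colimit
  -- presentation of `X`.
  · have hd : ∀ b, ∃ d : (j.obj b ⟶[V] X) ⊗ Z ⟶ W b, d ≫ i b = (𝟙 _ ⊛ g) := fun b =>
      ilift b _ _ (by rw [genComp_homPost, genComp_homPost, hg])
    choose d hd using hd
    obtain ⟨h, hh⟩ := (hj.isRepColimit X).exists_desc (fun b => d b ≫ l b) fun a b => by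
      have := hi a
      have e : _ ◁ d b ≫ m a b = (α_ _ _ _).inv ≫ (j.map a b ⊛ 𝟙 _) ▷ Z ≫ d a := by
        rw [← cancel_mono (i a)]
        simp only [Category.assoc]
        rw [hm, hd, whiskerLeft_genComp, hd, whiskerRight_genComp, Category.comp_id,
          genComp_assoc']
      rw [genComp_comp, hl, reassoc_of% e]
    refine ⟨h, (hj.isRepColimit X).hom_ext fun b => ?_⟩
    rw [← genComp_homPost, hh, Category.assoc, hk, hd]
  · refine (hj.isRepColimit X).hom_ext fun b => ?_
    have := hmono b
    rw [← cancel_mono (homPost (j.obj b) k), genComp_homPost, genComp_homPost, e]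

end

section HomExt

variable {V : Type u} [Category.{v} V] [MonoidalCategory V] [MonoidalClosed V]
  [SymmetricCategory V]
variable {C : Type w} [EnrichedCategory V C] {J : Type w₁} [EnrichedCategory V J]
variable {j : EnrichedFunctor V J C} {A : C} {D : EnrichedFunctor V J C} {K : C}
  {l : ∀ b, (j.obj b ⟶[V] A) ⟶ (D.obj b ⟶[V] K)}

/-- The braiding carries the factor `P` to the right, where `hom_ext_hom` absorbs it together with
`Z`. -/
theorem IsEleutheric.hom_ext_hom_two_sided (he : IsEleutheric j) (h : IsRepColimit j D l) (a : J)
    {P Z X : V} {g g' : P ⊗ ((j.obj a ⟶[V] K) ⊗ Z) ⟶ X}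
    (e : ∀ b, P ◁ (𝟙 (j.obj a ⟶[V] D.obj b) ⊛ l b) ▷ Z ≫ g =
      P ◁ (𝟙 (j.obj a ⟶[V] D.obj b) ⊛ l b) ▷ Z ≫ g') : g = g' := by
  rw [← cancel_epi (β_ _ _).hom, ← cancel_epi (α_ _ _ _).inv]
  refine he.hom_ext_hom h a fun b => ?_
  rw [associator_inv_naturality_left_assoc, associator_inv_naturality_left_assoc,
    BraidedCategory.braiding_naturality_left_assoc,
    BraidedCategory.braiding_naturality_left_assoc, e]

theorem IsEleutheric.hom_ext_hom_left (he : IsEleutheric j) (h : IsRepColimit j D l) (a : J)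
    {P X : V} {g g' : P ⊗ (j.obj a ⟶[V] K) ⟶ X}
    (e : ∀ b, P ◁ (𝟙 (j.obj a ⟶[V] D.obj b) ⊛ l b) ≫ g =
      P ◁ (𝟙 (j.obj a ⟶[V] D.obj b) ⊛ l b) ≫ g') : g = g' := by
  rw [← cancel_epi (β_ _ _).hom]
  refine he.hom_ext_hom h a fun b => ?_
  rw [BraidedCategory.braiding_naturality_left_assoc,
    BraidedCategory.braiding_naturality_left_assoc, e]

end HomExt

/-! ### Relative monads on `j` and their left Kan extensions. -/

section RelativeMonads

variable {V : Type u} [Category.{v} V] [MonoidalCategory V]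
variable {C : Type w} [EnrichedCategory V C] {J : Type w₁} [EnrichedCategory V J]

/-- A `V`-enriched relative monad on `j`, in extension form. -/
structure RelMonad (j : EnrichedFunctor V J C) where
  /-- the action on objects -/
  obj : J → C
  /-- the unit -/
  unit (a : J) : Mor V (j.obj a) (obj a)
  /-- the extension operation -/
  ext (a b : J) : (j.obj a ⟶[V] obj b) ⟶ (obj a ⟶[V] obj b)
  ext_unit (a b : J) : ext a b ≫ homPre (unit a) (obj b) = 𝟙 _
  unit_ext (a : J) : unit a ≫ ext a a = eId V (obj a)
  ext_ext (a b c : J) : (𝟙 (j.obj a ⟶[V] obj b) ⊛ ext b c) ≫ ext a c = ext a b ⊛ ext b c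

namespace RelMonad

variable {j : EnrichedFunctor V J C} (M : RelMonad j)

theorem genComp_ext {P Q : V} {a b c : J} (x : P ⟶ (j.obj a ⟶[V] M.obj b))
    (y : Q ⟶ (j.obj b ⟶[V] M.obj c)) :
    (x ⊛ y ≫ M.ext b c) ≫ M.ext a c = (x ≫ M.ext a b ⊛ y ≫ M.ext b c) := by
  rw [← tensorHom_genComp x y (M.ext a b), ← M.ext_ext, ← Category.assoc, tensorHom_genComp,
    Category.comp_id]

/-- The action on hom-objects of the `V`-functor underlying a relative monad. -/
def map (a b : J) : (a ⟶[V] b) ⟶ (M.obj a ⟶[V] M.obj b) :=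
  (j.map a b ≫ homPost (j.obj a) (M.unit b)) ≫ M.ext a b

theorem map_homPre_unit (a b : J) :
    M.map a b ≫ homPre (M.unit a) (M.obj b) = j.map a b ≫ homPost (j.obj a) (M.unit b) := by
  rw [map, Category.assoc, M.ext_unit, Category.comp_id]

theorem genComp_map_ext {P : V} {a b c : J} (x : P ⟶ (j.obj a ⟶[V] M.obj b)) :
    (x ⊛ M.map b c) ≫ M.ext a c = (x ≫ M.ext a b ⊛ M.map b c) :=
  M.genComp_ext _ _

/-- Every `y` is the restriction of its own extension along the unit; moving that unit to the left
factor makes the extension law applicable. -/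
theorem map_genComp_ext {Q : V} {a b c : J} (y : Q ⟶ (j.obj b ⟶[V] M.obj c)) :
    (j.map a b ⊛ y) ≫ M.ext a c = (M.map a b ⊛ y ≫ M.ext b c) := by
  have h : y = (y ≫ M.ext b c) ≫ homPre (M.unit b) (M.obj c) := by
    rw [Category.assoc, M.ext_unit, Category.comp_id]
  conv_lhs => rw [h, ← homPost_genComp, M.genComp_ext]
  rfl

/-- The `V`-functor underlying a relative monad. -/
@[reducible]
def functor : EnrichedFunctor V J C where
  obj := M.obj
  map := M.map
  map_id a := by
    rw [map, Category.assoc, j.map_id_assoc, ← Category.assoc, ← Mor.comp_eq_post, Mor.id_comp,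
      M.unit_ext]
  map_comp a b c := by
    rw [map, Category.assoc, j.map_comp_assoc, ← Category.assoc (_ ⊗ₘ _)]
    change (j.map a b ⊛ j.map b c) ≫ _ ≫ _ = M.map a b ⊛ M.map b c
    rw [← Category.assoc, genComp_homPost, M.map_genComp_ext]
    rfl

/-- A left Kan extension of a relative monad `M` along `j`. -/
structure Kan where
  /-- the action on objects -/
  obj : C → C
  /-- the colimit cylinders -/
  ι (A : C) (b : J) : (j.obj b ⟶[V] A) ⟶ (M.obj b ⟶[V] obj A)
  isColimit (A : C) : IsRepColimit j M.functor (ι A)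

theorem Kan.ι_nat {M : RelMonad j} (L : M.Kan) (A : C) (a b : J) :
    (M.map a b ⊛ L.ι A b) = (j.map a b ⊛ 𝟙 _) ≫ L.ι A a :=
  (L.isColimit A).nat a b

end RelMonad

end RelativeMonads

section KanExtension

variable {V : Type u} [Category.{v} V] [MonoidalCategory V] [MonoidalClosed V]
  [SymmetricCategory V]
variable {C : Type w} [EnrichedCategory V C] {J : Type w₁} [EnrichedCategory V J]
variable {j : EnrichedFunctor V J C}

theorem IsEleutheric.nonempty_kan (he : IsEleutheric j) (M : RelMonad j) : Nonempty M.Kan := by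
  choose K l h using fun A => he.exists_isRepColimit A M.functor
  exact ⟨⟨K, l, h⟩⟩

namespace RelMonad.Kan

variable {M : RelMonad j} (L : M.Kan) (he : IsEleutheric j) (hj : IsDense j)

-- A morphism `j a ⟶ L A` is built from pairs `j a ⟶ M b`, `j b ⟶ A`, because `C(j a, -)` preserves
-- the colimit `L A`. Extending the first component along `M.ext` gives a morphism `M a ⟶ L A`;
-- compatibility in `b` is naturality of `M.ext`.
include he in
theorem exists_extJ (a : J) (A : C) : ∃ κ : (j.obj a ⟶[V] L.obj A) ⟶ (M.obj a ⟶[V] L.obj A),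
    ∀ b, (𝟙 (j.obj a ⟶[V] M.obj b) ⊛ L.ι A b) ≫ κ = M.ext a b ⊛ L.ι A b :=
  he.exists_mor_hom (L.isColimit A) a (fun b => M.ext a b ⊛ L.ι A b) fun b c => by
    rw [whiskerLeft_genComp, ← L.ι_nat, whiskerRight_genComp, M.genComp_map_ext, Category.id_comp,
      genComp_assoc']

/-- Extension of morphisms from objects of `J` into the values of the Kan extension. -/
def extJ (a : J) (A : C) : (j.obj a ⟶[V] L.obj A) ⟶ (M.obj a ⟶[V] L.obj A) :=
  (L.exists_extJ he a A).choose

theorem id_ι_extJ (a b : J) (A : C) :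
    (𝟙 (j.obj a ⟶[V] M.obj b) ⊛ L.ι A b) ≫ L.extJ he a A = M.ext a b ⊛ L.ι A b :=
  (L.exists_extJ he a A).choose_spec b

theorem genComp_ι_extJ {P Q : V} {a b : J} {A : C} (x : P ⟶ (j.obj a ⟶[V] M.obj b))
    (y : Q ⟶ (j.obj b ⟶[V] A)) :
    (x ⊛ y ≫ L.ι A b) ≫ L.extJ he a A = (x ≫ M.ext a b ⊛ y ≫ L.ι A b) := by
  rw [← tensorHom_genComp x y (M.ext a b), ← L.id_ι_extJ he, ← Category.assoc, tensorHom_genComp,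
    Category.comp_id]

theorem genComp_ι_extJ' {P : V} {a b : J} {A : C} (x : P ⟶ (j.obj a ⟶[V] M.obj b)) :
    (x ⊛ L.ι A b) ≫ L.extJ he a A = (x ≫ M.ext a b ⊛ L.ι A b) := by
  simpa using L.genComp_ι_extJ he x (𝟙 (j.obj b ⟶[V] A))

theorem extJ_nat (a b : J) (A : C) :
    (M.map a b ⊛ L.extJ he b A) = (j.map a b ⊛ 𝟙 _) ≫ L.extJ he a A := by
  refine he.hom_ext_hom_left (L.isColimit A) b fun c => ?_
  rw [whiskerLeft_genComp, id_ι_extJ, ← Category.assoc, whiskerLeft_genComp, Category.comp_id,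
    genComp_assoc' (j.map a b), Category.assoc, genComp_ι_extJ', M.map_genComp_ext,
    Category.id_comp,
    genComp_assoc']

theorem extJ_unit (a : J) (A : C) :
    L.extJ he a A ≫ homPre (M.unit a) (L.obj A) = 𝟙 _ := by
  refine he.mor_ext_hom (L.isColimit A) a fun b => ?_
  rw [← Category.assoc, id_ι_extJ, genComp_homPre, M.ext_unit, Category.comp_id]

theorem ι_unit_extJ (a : J) (A : C) :
    L.ι A a ≫ homPre (M.unit a) (L.obj A) ≫ L.extJ he a A = L.ι A a := by
  have h := L.genComp_ι_extJ' he (A := A) (M.unit a)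
  rw [M.unit_ext, mor_genComp, mor_genComp, homPre_id] at h
  simpa using h

theorem genComp_extJ_extJ (a b : J) (A : C) :
    (𝟙 (j.obj a ⟶[V] M.obj b) ⊛ L.extJ he b A) ≫ L.extJ he a A = M.ext a b ⊛ L.extJ he b A := by
  refine he.hom_ext_hom_left (L.isColimit A) b fun c => ?_
  rw [← Category.assoc, whiskerLeft_genComp, whiskerLeft_genComp, id_ι_extJ, genComp_assoc',
    genComp_assoc', Category.assoc, genComp_ι_extJ', M.ext_ext]

-- To extend `A ⟶ L B` to `L A`, precompose with each `j b ⟶ A`, apply `extJ`, and glue over the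
-- colimit `L A`.
include he in
theorem exists_ext (A B : C) : ∃ e : (A ⟶[V] L.obj B) ⟶ (L.obj A ⟶[V] L.obj B),
    ∀ b, (L.ι A b ⊛ e) = (𝟙 _ ⊛ 𝟙 _) ≫ L.extJ he b B :=
  (L.isColimit A).exists_desc (fun b => (𝟙 _ ⊛ 𝟙 _) ≫ L.extJ he b B) fun a b => by
    have h := L.extJ_nat he a b B
    rw [genComp_comp, h, ← Category.assoc, whiskerLeft_genComp, Category.comp_id,
      ← Category.assoc (_ ▷ _), whiskerRight_genComp, Category.comp_id, genComp_assoc',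
      Category.assoc]

/-- The extension operation of the Kan extension. -/
def ext (A B : C) : (A ⟶[V] L.obj B) ⟶ (L.obj A ⟶[V] L.obj B) := (L.exists_ext he A B).choose

theorem ι_ext (A B : C) (b : J) : (L.ι A b ⊛ L.ext he A B) = (𝟙 _ ⊛ 𝟙 _) ≫ L.extJ he b B :=
  (L.exists_ext he A B).choose_spec b

theorem ι_comp_ext {A B : C} (b : J) {P : V} (x : P ⟶ (A ⟶[V] L.obj B)) :
    (L.ι A b ⊛ x ≫ L.ext he A B) = (𝟙 _ ⊛ x) ≫ L.extJ he b B := by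
  rw [genComp_comp, ι_ext, ← Category.assoc, whiskerLeft_genComp, Category.comp_id]

-- By density a morphism out of `A` is a natural family on the objects `C(j b, A)`; the family used
-- restricts the colimit cylinder along the units of `M`.
include hj in
theorem exists_η (A : C) : ∃ η : Mor V A (L.obj A),
    ∀ b, homPost (j.obj b) η = L.ι A b ≫ homPre (M.unit b) (L.obj A) := by
  obtain ⟨η, h⟩ := (hj.isRepColimit A).exists_mor (fun b => L.ι A b ≫ homPre (M.unit b) (L.obj A))
    fun a b => by
      rw [← homPost_genComp, ← Category.assoc, ← L.ι_nat, genComp_homPre, M.map_homPre_unit]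
  exact ⟨η, fun b => by rw [← h, Category.id_comp]⟩

/-- The unit of the Kan extension. -/
def η (A : C) : Mor V A (L.obj A) := (L.exists_η hj A).choose

theorem homPost_η (A : C) (b : J) :
    homPost (j.obj b) (L.η hj A) = L.ι A b ≫ homPre (M.unit b) (L.obj A) :=
  (L.exists_η hj A).choose_spec b

theorem homPost_η_extJ (A : C) (b : J) :
    homPost (j.obj b) (L.η hj A) ≫ L.extJ he b A = L.ι A b := by
  rw [homPost_η, Category.assoc, ι_unit_extJ]

/-- The extension law of the Kan extension with its first arity in `J`; the general law `ext_ext` of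
`kleisli` follows by testing on the colimit cylinder of `L A`. -/
theorem genComp_ext_extJ (b : J) (A B : C) :
    (𝟙 (j.obj b ⟶[V] L.obj A) ⊛ L.ext he A B) ≫ L.extJ he b B = L.extJ he b A ⊛ L.ext he A B := by
  refine he.hom_ext_hom (L.isColimit A) b fun c => ?_
  rw [← Category.assoc, whiskerRight_genComp, whiskerRight_genComp, id_ι_extJ, Category.comp_id,
    genComp_assoc, genComp_assoc, ι_ext, genComp_comp _ (M.ext b c), ← genComp_extJ_extJ,
    genComp_comp, Category.assoc, Category.assoc]

/-- The Kan extension of a relative monad as a Kleisli triple. -/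
@[reducible]
def kleisli : KleisliTriple V C where
  obj := L.obj
  η := L.η hj
  ext := L.ext he
  ext_η A B := by
    refine (hj.isRepColimit A).hom_ext fun b => ?_
    rw [← homPost_genComp, Category.id_comp, homPost_η, ← genComp_homPre, ι_ext, Category.assoc,
      extJ_unit, Category.comp_id]
  η_ext A := by
    refine (L.isColimit A).hom_ext fun b => ?_
    rw [ι_comp_ext, genComp_mor, genComp_mor, homPost_id, Category.id_comp, Category.assoc,
      homPost_η_extJ, Category.comp_id]
  ext_ext A B D := by
    refine (L.isColimit A).hom_ext fun b => ?_
    rw [ι_comp_ext, genComp_assoc', genComp_assoc', ι_ext, comp_genComp, ← genComp_ext_extJ,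
      ← Category.assoc (_ ▷ _), whiskerRight_genComp, Category.comp_id, Category.assoc]

end RelMonad.Kan

end KanExtension

section KanComparison

variable {V : Type u} [Category.{v} V] [MonoidalCategory V]
variable {C : Type w} [EnrichedCategory V C] {J : Type w₁} [EnrichedCategory V J]
variable {j : EnrichedFunctor V J C} {M : RelMonad j} {T : VMonad V C}
  {σ : ∀ a, Mor V (M.obj a) (T.T.obj (j.obj a))}

theorem RelMonad.Kan.exists_homApp (L : M.Kan)
    (unit : ∀ a, M.unit a ⋄ σ a = T.η (j.obj a))
    (ext : ∀ a b, M.ext a b ≫ homPost (M.obj a) (σ b) =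
      homPost (j.obj a) (σ b) ≫ T.T.map (j.obj a) (T.T.obj (j.obj b)) ≫
        homPost (T.T.obj (j.obj a)) (T.μ (j.obj b)) ≫ homPre (σ a) (T.T.obj (j.obj b))) (A : C) :
    ∃ φ : Mor V (L.obj A) (T.T.obj A), ∀ b, L.ι A b ≫ homPost (M.obj b) φ =
      T.T.map (j.obj b) A ≫ homPre (σ b) (T.T.obj A) := by
  refine (L.isColimit A).exists_mor (fun b => T.T.map (j.obj b) A ≫ homPre (σ b) (T.T.obj A))
    fun a b => ?_
  -- Naturality of `σ` is forced by its compatibility with units and extensions, as for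
  -- `map_homPost_of_ext`.
  have h : M.map a b ≫ homPost (M.obj a) (σ b) =
      j.map a b ≫ T.T.map _ _ ≫ homPre (σ a) (T.T.obj (j.obj b)) := by
    rw [RelMonad.map, Category.assoc, ext, Category.assoc,
      ← Category.assoc (homPost _ _) (homPost _ _),
      ← homPost_comp, unit, reassoc_of% (homPost_map T.T (j.obj a) (T.η (j.obj b))),
      ← Category.assoc (homPost _ _) (homPost _ _), ← homPost_comp, T.right_unit, homPost_id,
      Category.id_comp]
  rw [← homPost_genComp, h, genComp_map_assoc, Category.id_comp, genComp_homPre, Category.assoc]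

end KanComparison

section KanMonad

variable {V : Type u} [Category.{v} V] [MonoidalCategory V] [MonoidalClosed V]
  [SymmetricCategory V]
variable {C : Type w} [EnrichedCategory V C] {J : Type w₁} [EnrichedCategory V J]
variable {j : EnrichedFunctor V J C}

namespace RelMonad.Kan

variable {M : RelMonad j} (L : M.Kan) (he : IsEleutheric j) (hj : IsDense j)

/-- The action on hom-objects of the Kan extension. -/
abbrev map (A B : C) : (A ⟶[V] B) ⟶ (L.obj A ⟶[V] L.obj B) := (L.kleisli he hj).map A B

/-- The functorial action derived from the extension operation is the one that the Kan extension
carries as a colimit in its weight. -/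
theorem ι_map (A B : C) (b : J) :
    (L.ι A b ⊛ L.map he hj A B) = (𝟙 (j.obj b ⟶[V] A) ⊛ 𝟙 _) ≫ L.ι B b := by
  rw [map, KleisliTriple.map, ι_comp_ext, ← homPost_η_extJ L he hj, ← Category.assoc (_ ⊛ _),
    genComp_homPost, Category.id_comp]

theorem ι_comp_map {A B : C} (b : J) {P : V} (x : P ⟶ (A ⟶[V] B)) :
    (L.ι A b ⊛ x ≫ L.map he hj A B) = (𝟙 (j.obj b ⟶[V] A) ⊛ x) ≫ L.ι B b := by
  rw [genComp_comp, ι_map, ← Category.assoc, whiskerLeft_genComp, Category.comp_id]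

section Preservation

variable {A : C} {D : EnrichedFunctor V J C} {K : C} {l : ∀ b, (j.obj b ⟶[V] A) ⟶ (D.obj b ⟶[V] K)}

theorem hom_ext_map (h : IsRepColimit j D l) {Z : V} {X : C} {g g' : Z ⟶ (L.obj K ⟶[V] X)}
    (e : ∀ b, (l b ≫ L.map he hj (D.obj b) K ⊛ g) = (l b ≫ L.map he hj (D.obj b) K ⊛ g')) :
    g = g' := by
  refine (L.isColimit K).hom_ext fun c => he.hom_ext_hom h c fun b => ?_
  rw [whiskerRight_genComp, whiskerRight_genComp, ← ι_comp_map L he hj, genComp_assoc,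
    genComp_assoc, e]

/-- An interchange of colimits: `L K` is a colimit of the objects `M c` weighted by `C(j c, K)`, and
each `C(j c, K)` is in turn a colimit of the objects `C(j c, D b)`. -/
theorem exists_desc_map (h : IsRepColimit j D l) {Z : V} {X : C}
    (f : ∀ b, (j.obj b ⟶[V] A) ⊗ Z ⟶ (L.obj (D.obj b) ⟶[V] X))
    (hf : ∀ a b : J, (D.map a b ≫ L.map he hj (D.obj a) (D.obj b) ⊛ f b) =
      (α_ _ _ _).inv ≫ (j.map a b ⊛ 𝟙 (j.obj b ⟶[V] A)) ▷ Z ≫ f a) :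
    ∃ g : Z ⟶ (L.obj K ⟶[V] X), ∀ b, (l b ≫ L.map he hj (D.obj b) K ⊛ g) = f b := by
  -- Inner gluing, over `b` with `c` fixed; the morphisms `t c` are then glued over `c`.
  have h1 : ∀ c, ∃ t : (j.obj c ⟶[V] K) ⊗ Z ⟶ (M.obj c ⟶[V] X), ∀ b,
      (α_ _ _ _).inv ≫ (𝟙 (j.obj c ⟶[V] D.obj b) ⊛ l b) ▷ Z ≫ t =
        (L.ι (D.obj b) c ⊛ f b) := fun c =>
    he.exists_desc_hom h c (fun b => L.ι (D.obj b) c ⊛ f b) fun a b => by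
      rw [whiskerRight_genComp, ← ι_comp_map L he hj, whiskerLeft_genComp, Category.assoc, ← hf,
        genComp_assoc']
  choose t ht using h1
  obtain ⟨g, hg⟩ := (L.isColimit K).exists_desc t fun c d => by
    refine he.hom_ext_hom_two_sided h d fun b => ?_
    have e : (j.map c d ⊛ 𝟙 (j.obj d ⟶[V] D.obj b) ⊛ l b) =
        (α_ _ _ _).inv ≫ (j.map c d ⊛ 𝟙 (j.obj d ⟶[V] D.obj b)) ▷ _ ≫ (𝟙 _ ⊛ l b) := by
      rw [genComp_assoc', whiskerRight_genComp, Category.comp_id]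
    rw [whiskerLeft_genComp, ← cancel_epi (_ ◁ (α_ _ _ _).inv), whiskerLeft_genComp, ht,
      genComp_assoc', L.ι_nat, comp_genComp, ← ht, associator_inv_naturality_middle_assoc,
      ← comp_whiskerRight_assoc, whiskerLeft_genComp, Category.comp_id, e]
    simp
  refine ⟨g, fun b => (L.isColimit (D.obj b)).hom_ext fun c => ?_⟩
  rw [genComp_assoc', ι_comp_map, comp_genComp, hg, ht]

end Preservation

theorem isJAry : IsJAry j (L.kleisli he hj).functor :=
  isJAry_of_isRepColimit fun _ D K l h =>
    { nat := fun a b => by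
        have e := h.nat a b =≫ (L.kleisli he hj).map (D.obj a) K
        rw [Category.assoc, genComp_map (L.kleisli he hj).functor] at e
        exact e
      exists_desc := L.exists_desc_map he hj h
      hom_ext := L.hom_ext_map he hj h }

/-- The `J`-ary `V`-monad generated by a relative monad. -/
def monad : JMonad j := ⟨(L.kleisli he hj).toVMonad, L.isJAry he hj⟩

section Hom

variable {T : VMonad V C} {σ : ∀ a, Mor V (M.obj a) (T.T.obj (j.obj a))}

variable {φ : ∀ A, Mor V (L.obj A) (T.T.obj A)}

theorem η_homApp (unit : ∀ a, M.unit a ⋄ σ a = T.η (j.obj a))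
    (hφ : ∀ A b, L.ι A b ≫ homPost (M.obj b) (φ A) =
      T.T.map (j.obj b) A ≫ homPre (σ b) (T.T.obj A)) (A : C) : L.η hj A ⋄ φ A = T.η A := by
  refine (hj.isRepColimit A).mor_ext fun b => ?_
  rw [Category.id_comp, Category.id_comp, homPost_comp, homPost_η, Category.assoc, homPre_homPost,
    ← Category.assoc, hφ, T.η_naturality, Category.assoc, ← homPre_comp, unit]

/-- Both sides are determined by pairs `j b ⟶ M c`, `j c ⟶ A`. On those the claim reduces to the
compatibility of `σ` with extensions and to naturality of `T.μ`. -/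
theorem extJ_homApp
    (ext : ∀ a b, M.ext a b ≫ homPost (M.obj a) (σ b) =
      homPost (j.obj a) (σ b) ≫ T.T.map (j.obj a) (T.T.obj (j.obj b)) ≫
        homPost (T.T.obj (j.obj a)) (T.μ (j.obj b)) ≫ homPre (σ a) (T.T.obj (j.obj b)))
    (hφ : ∀ A b, L.ι A b ≫ homPost (M.obj b) (φ A) =
      T.T.map (j.obj b) A ≫ homPre (σ b) (T.T.obj A)) (A : C) (b : J) :
    L.extJ he b A ≫ homPost (M.obj b) (φ A) = homPost (j.obj b) (φ A) ≫
      T.T.map (j.obj b) (T.T.obj A) ≫ homPost (T.T.obj (j.obj b)) (T.μ A) ≫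
        homPre (σ b) (T.T.obj A) := by
  refine he.mor_ext_hom (L.isColimit A) b fun c => ?_
  rw [← Category.assoc, id_ι_extJ, genComp_homPost, hφ, ← homPost_genComp, ext,
    genComp_homPost_assoc, hφ, ← homPost_genComp, Category.id_comp, genComp_map_assoc,
    genComp_homPost_assoc, Category.assoc, T.μ_naturality, ← homPost_genComp, genComp_homPre]
  simp only [Category.assoc]

theorem ext_homApp
    (ext : ∀ a b, M.ext a b ≫ homPost (M.obj a) (σ b) =
      homPost (j.obj a) (σ b) ≫ T.T.map (j.obj a) (T.T.obj (j.obj b)) ≫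
        homPost (T.T.obj (j.obj a)) (T.μ (j.obj b)) ≫ homPre (σ a) (T.T.obj (j.obj b)))
    (hφ : ∀ A b, L.ι A b ≫ homPost (M.obj b) (φ A) =
      T.T.map (j.obj b) A ≫ homPre (σ b) (T.T.obj A)) (A B : C) :
    L.ext he A B ≫ homPost (L.obj A) (φ B) = homPost A (φ B) ≫ T.T.map A (T.T.obj B) ≫
      homPost (T.T.obj A) (T.μ B) ≫ homPre (φ A) (T.T.obj B) := by
  refine (L.isColimit A).hom_ext fun b => ?_
  rw [← genComp_homPost, ι_ext, Category.assoc, extJ_homApp L he ext hφ]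
  rw [genComp_homPost_assoc, genComp_map_assoc, genComp_homPost_assoc, genComp_homPre]
  simp only [← Category.assoc]
  rw [← homPost_genComp, hφ, Category.id_comp, Category.id_comp]

end Hom

end RelMonad.Kan

end KanMonad

/-! ### Operations on algebras, and the operations that a morphism preserves. -/

section AlgebraActions

variable {V : Type u} [Category.{v} V] [MonoidalCategory V]
variable {C : Type w} [EnrichedCategory V C] {T : VMonad V C}

/-- The free algebra on `D`. -/
@[reducible]
def VMonad.freeAlgebra (T : VMonad V C) (D : C) : T.Algebra where
  A := T.T.obj D
  a := T.μ D
  unit := T.left_unit D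
  assoc := (T.assoc D).symm

namespace VMonad.Algebra

/-- The action `C(D, A) ⟶ C(T D, A)` of an algebra `A`: apply `T`, then compose with the structure
morphism. -/
def act (X : T.Algebra) (D : C) : (D ⟶[V] X.A) ⟶ (T.T.obj D ⟶[V] X.A) :=
  T.T.map D X.A ≫ homPost (T.T.obj D) X.a

theorem act_homPre_η (X : T.Algebra) (D : C) : X.act D ≫ homPre (T.η D) X.A = 𝟙 _ := by
  rw [act, Category.assoc, ← homPre_homPost, ← Category.assoc, ← T.η_naturality, ← homPost_comp,
    X.unit, homPost_id]

theorem genComp_act (X : T.Algebra) {K D : C} {P Q : V} (x : P ⟶ (K ⟶[V] D))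
    (y : Q ⟶ (D ⟶[V] X.A)) : (x ⊛ y) ≫ X.act K = (x ≫ T.T.map K D ⊛ y ≫ X.act D) := by
  rw [act, genComp_map_assoc, genComp_homPost, act, Category.assoc]

/-- Substitution of operations: evaluating after a Kleisli extension equals extending the
evaluation. It combines associativity of the algebra `X` with naturality of `μ`. -/
theorem free_act_genComp_act (X : T.Algebra) {K D : C} {P Q : V} (x : P ⟶ (K ⟶[V] T.T.obj D))
    (y : Q ⟶ (D ⟶[V] X.A)) :
    (x ≫ (T.freeAlgebra D).act K ⊛ y ≫ X.act D) = (x ⊛ y ≫ X.act D) ≫ X.act K := by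
  rw [genComp_act, act, ← Category.assoc, homPost_genComp]
  simp only [act, Category.assoc]
  rw [reassoc_of% (homPost_map T.T (T.T.obj D) X.a), ← homPost_comp, ← X.assoc, homPost_comp,
    reassoc_of% (T.μ_naturality D X.A), homPre_homPost]

theorem free_act_genComp_act' (X : T.Algebra) {K D : C} {P : V} (x : P ⟶ (K ⟶[V] T.T.obj D)) :
    (x ≫ (T.freeAlgebra D).act K ⊛ X.act D) = (x ⊛ X.act D) ≫ X.act K := by
  simpa using X.free_act_genComp_act x (𝟙 (D ⟶[V] X.A))

theorem homPost_genComp_act (X : T.Algebra) {K E D : C} (σ : Mor V E (T.T.obj D)) :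
    homPost K σ ≫ (T.freeAlgebra D).act K ⊛ X.act D = (homPost K σ ⊛ X.act D) ≫ X.act K :=
  X.free_act_genComp_act' _

end VMonad.Algebra

end AlgebraActions

section SubRelativeMonads

variable {V : Type u} [Category.{v} V] [MonoidalCategory V]
variable {C : Type w} [EnrichedCategory V C] {J : Type w₁} [EnrichedCategory V J]
variable {j : EnrichedFunctor V J C} {T : VMonad V C}

/-- The relative monad structure on a family of subobjects of `T (j a)` that is closed under the
unit and the extension operation of `T`. -/
@[reducible]
def RelMonad.ofSubobjects {E : J → C} (σ : ∀ a, Mor V (E a) (T.T.obj (j.obj a)))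
    (hσ : ∀ X a, Mono (homPost X (σ a))) (unit : ∀ a, Mor V (j.obj a) (E a))
    (hunit : ∀ a, unit a ⋄ σ a = T.η (j.obj a))
    (ext : ∀ a b, (j.obj a ⟶[V] E b) ⟶ (E a ⟶[V] E b))
    (hext : ∀ a b, ext a b ≫ homPost (E a) (σ b) = homPost (j.obj a) (σ b) ≫
      (T.freeAlgebra (j.obj b)).act (j.obj a) ≫ homPre (σ a) (T.T.obj (j.obj b))) :
    RelMonad j where
  obj := E
  unit := unit
  ext := ext
  ext_unit a b := by
    have := hσ (j.obj a) b
    rw [← cancel_mono (homPost (j.obj a) (σ b)), Category.assoc, homPre_homPost, ← Category.assoc,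
      hext, Category.assoc, Category.assoc, ← homPre_comp, hunit]
    rw [VMonad.Algebra.act_homPre_η, Category.comp_id, Category.id_comp]
  unit_ext a := by
    have := hσ (E a) a
    rw [← cancel_mono (homPost (E a) (σ a)), Category.assoc, hext, ← Category.assoc,
      ← Mor.comp_eq_post, hunit, ← Mor.comp_eq_post, Mor.id_comp, VMonad.Algebra.act,
      ← Category.assoc,
      ← Category.assoc]
    have h := T.right_unit (j.obj a)
    rw [Mor.comp_eq_post, mapMor] at h
    rw [h, ← Mor.comp_eq_pre, Mor.comp_id]
  ext_ext a b c := by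
    have := hσ (E a) c
    rw [← cancel_mono (homPost (E a) (σ c)), Category.assoc, hext, genComp_homPost_assoc, hext,
      genComp_homPost, hext, ← Category.assoc (homPost (j.obj b) (σ c)),
      ← homPost_genComp, ← homPost_genComp, hext, Category.id_comp,
      ← Category.assoc (homPost (j.obj a) (σ b)), ← genComp_homPre,
      (T.freeAlgebra (j.obj c)).free_act_genComp_act (homPost (j.obj a) (σ b))
        (homPost (j.obj b) (σ c)), Category.assoc]

end SubRelativeMonads

section HomClosure

variable {V : Type u} [Category.{v} V] [MonoidalCategory V]
variable {C : Type w} [EnrichedCategory V C]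

/-- Transposing into the cotensor turns an equation between morphisms of `V` into one between
morphisms into an object of `C`; so the operations preserved by a generalized morphism can be cut
out by an equalizer in `C`. -/
theorem Cotensor.homPost_lift_eq_iff {X : V} {A B K : C} (c : Cotensor X A)
    (f g : X ⟶ (B ⟶[V] A)) {P : V} (x y : P ⟶ (K ⟶[V] B)) :
    x ≫ homPost K (c.lift ((λ_ X).hom ≫ f)) = y ≫ homPost K (c.lift ((λ_ X).hom ≫ g)) ↔
      (x ⊛ f) = (y ⊛ g) := by
  have h : ∀ (f : X ⟶ (B ⟶[V] A)) (x : P ⟶ (K ⟶[V] B)),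
      (x ≫ homPost K (c.lift ((λ_ X).hom ≫ f)) ⊛ c.counit) = (x ⊛ f) := fun f x => by
    have e : (c.lift ((λ_ X).hom ≫ f) ⊛ c.counit) = (λ_ X).hom ≫ f := c.fac _
    rw [mor_genComp] at e
    rw [homPost_genComp, (cancel_epi _).1 e]
  refine ⟨fun e => by rw [← h f, ← h g, e], fun e => ?_⟩
  rw [← h f, ← h g] at e
  exact (c.uniq _ _ e).trans (c.uniq _ _ rfl).symm

section

variable {T : VMonad V C} (X Y : T.Algebra) {Z : V} (f : Z ⟶ (X.A ⟶[V] Y.A))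

/-- The first of the two morphisms that compare a generalized morphism `f` between algebras with
the `T`-operations of arity `D`: apply the operation, then `f`. -/
abbrev actThen (D : C) : (D ⟶[V] X.A) ⊗ Z ⟶ (T.T.obj D ⟶[V] Y.A) := X.act D ⊛ f

/-- The second of the two morphisms that compare a generalized morphism `f` between algebras with
the `T`-operations of arity `D`: apply `f`, then the operation. -/
abbrev thenAct (D : C) : (D ⟶[V] X.A) ⊗ Z ⟶ (T.T.obj D ⟶[V] Y.A) :=
  (𝟙 (D ⟶[V] X.A) ⊛ f) ≫ Y.act D

variable {X Y f}

/-- Variables are preserved by every `f`, whether or not it is a homomorphism. -/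
theorem actThen_homPre_η (D : C) :
    actThen X Y f D ≫ homPre (T.η D) Y.A = thenAct X Y f D ≫ homPre (T.η D) Y.A := by
  rw [actThen, thenAct, genComp_homPre, X.act_homPre_η, Category.assoc, Y.act_homPre_η,
    Category.comp_id]

/-- Preserved operations are closed under substitution: `h` moves `f` past the outer operation in
`E`, `h'` past the inner ones in `E'`, and `free_act_genComp_act` reassembles the result. -/
theorem ext_genComp_actThen {D E D' E' : C} {σ : Mor V E (T.T.obj D)} {σ' : Mor V E' (T.T.obj D')}
    (h : actThen X Y f D ≫ homPre σ Y.A = thenAct X Y f D ≫ homPre σ Y.A)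
    (h' : actThen X Y f D' ≫ homPre σ' Y.A = thenAct X Y f D' ≫ homPre σ' Y.A) :
    (homPost D σ' ≫ (T.freeAlgebra D').act D ≫ homPre σ (T.T.obj D') ⊛ actThen X Y f D') =
      (homPost D σ' ≫ (T.freeAlgebra D').act D ≫ homPre σ (T.T.obj D') ⊛ thenAct X Y f D') := by
  have hl : (homPost D σ' ≫ (T.freeAlgebra D').act D ⊛ actThen X Y f D') ≫ homPre σ Y.A =
      (homPost D σ' ⊛ thenAct X Y f D') ≫ Y.act D ≫ homPre σ Y.A := by
    rw [actThen, genComp_assoc', VMonad.Algebra.homPost_genComp_act, comp_genComp]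
    simp only [Category.assoc]
    rw [h, thenAct, Category.assoc, whiskerRight_genComp_assoc, Category.comp_id, ← Category.assoc,
      ← genComp_assoc', ← Category.id_comp (homPost D σ'), homPost_genComp, h', ← homPost_genComp]
  have hr : (homPost D σ' ≫ (T.freeAlgebra D').act D ⊛ thenAct X Y f D') ≫ homPre σ Y.A =
      (homPost D σ' ⊛ thenAct X Y f D') ≫ Y.act D ≫ homPre σ Y.A := by
    rw [thenAct, VMonad.Algebra.free_act_genComp_act, Category.assoc]
  rw [← Category.assoc, ← genComp_homPre, hl, ← genComp_homPre, hr]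

theorem map_genComp_actThen (D D' : C) : (T.T.map D' D ⊛ actThen X Y f D) =
    (α_ _ _ _).inv ≫ (𝟙 (D' ⟶[V] D) ⊛ 𝟙 _) ▷ Z ≫ actThen X Y f D' := by
  rw [whiskerRight_genComp, VMonad.Algebra.genComp_act, Category.id_comp, Category.id_comp,
    genComp_assoc']

theorem map_genComp_thenAct (D D' : C) : (T.T.map D' D ⊛ thenAct X Y f D) =
    (α_ _ _ _).inv ≫ (𝟙 (D' ⟶[V] D) ⊛ 𝟙 _) ▷ Z ≫ thenAct X Y f D' := by
  rw [thenAct, thenAct, whiskerRight_genComp_assoc, Category.comp_id, ← Category.assoc,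
    ← genComp_assoc', Y.genComp_act (𝟙 _) (𝟙 _ ⊛ f), Category.id_comp]

end

end HomClosure

/-! ### Homomorphisms between algebras for a free monad. -/

section FreeMonads

variable {V : Type u} [Category.{v} V] [MonoidalCategory V] [MonoidalClosed V]
  [SymmetricCategory V]
variable {C : Type w} [EnrichedCategory V C]

section

variable {J : Type w₁} [EnrichedCategory V J] {j : EnrichedFunctor V J C} {T : VMonad V C}

/-- The morphism of `V`-monads from the Kan extension of a relative monad `M` to `T` induced by a
morphism of relative monads `M ⟶ T ∘ j`. -/
theorem RelMonad.Kan.exists_hom {M : RelMonad j} (L : M.Kan) (he : IsEleutheric j)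
    (hj : IsDense j) {σ : ∀ a, Mor V (M.obj a) (T.T.obj (j.obj a))}
    (unit : ∀ a, M.unit a ⋄ σ a = T.η (j.obj a))
    (ext : ∀ a b, M.ext a b ≫ homPost (M.obj a) (σ b) = homPost (j.obj a) (σ b) ≫
      (T.freeAlgebra (j.obj b)).act (j.obj a) ≫ homPre (σ a) (T.T.obj (j.obj b))) :
    ∃ Φ : (L.kleisli he hj).toVMonad ⟶ T, ∀ A b, L.ι A b ≫ homPost (M.obj b) (Φ.trans.app A) =
      T.T.map (j.obj b) A ≫ homPre (σ b) (T.T.obj A) := by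
  simp only [VMonad.Algebra.act, Category.assoc] at ext
  choose φ hφ using L.exists_homApp unit ext
  exact ⟨KleisliTriple.homOf (L.kleisli he hj) T φ (L.η_homApp hj unit hφ) (L.ext_homApp he ext hφ),
    hφ⟩

/-- The generalized morphisms of algebras are determined by the operations with arities in `J`. -/
theorem IsJAry.actThen_eq (hT : IsJAry j T.T) (hj : IsDense j) {X Y : T.Algebra} {Z : V}
    {f : Z ⟶ (X.A ⟶[V] Y.A)}
    (h : ∀ a, actThen X Y f (j.obj a) = thenAct X Y f (j.obj a)) :
    f ≫ homPre X.a Y.A = f ≫ T.T.map X.A Y.A ≫ homPost (T.T.obj X.A) Y.a := by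
  -- As `T` preserves the canonical colimit of `X.A`, equality on `T X.A` can be tested along the
  -- morphisms `T (j a) ⟶ T X.A`.
  refine (hT.isRepColimit (hj.isRepColimit X.A)).hom_ext fun a => ?_
  have h1 := h a
  rw [actThen, thenAct, VMonad.Algebra.genComp_act, Category.id_comp] at h1
  have h2 : (T.T.map (j.obj a) X.A ⊛ f ≫ homPre X.a Y.A) =
      (T.T.map (j.obj a) X.A ⊛ f ≫ T.T.map X.A Y.A ≫ homPost (T.T.obj X.A) Y.a) := by
    rw [← homPost_genComp]
    exact h1
  have e : 𝟙 (j.obj a ⟶[V] X.A) ≫ T.T.map (j.obj a) X.A = T.T.map (j.obj a) X.A :=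
    Category.id_comp _
  rw [← e] at h2
  exact h2

/-- A morphism of monads to a free monad `F` splits on the objects of `J` if the unit of `F` factors
through it. -/
theorem FreeJMonad.exists_section {S : Sig j} (F : FreeJMonad j S) {N : JMonad j}
    (Φ : N.obj ⟶ F.monad.obj) (t : ∀ a, Mor V (S a) (N.obj.T.obj (j.obj a)))
    (ht : ∀ a, t a ⋄ Φ.trans.app (j.obj a) = F.unit a) :
    ∃ ψ : ∀ a, Mor V (F.monad.obj.T.obj (j.obj a)) (N.obj.T.obj (j.obj a)),
      ∀ a, ψ a ⋄ Φ.trans.app (j.obj a) = eId V (F.monad.obj.T.obj (j.obj a)) := by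
  let Ψ : N ⟶ F.monad := ⟨Φ⟩
  let t' : S ⟶ (sigOf j).obj N := t
  -- Both sides are endomorphisms of the free monad that restrict to its unit on generators.
  have h : F.desc t' ≫ Ψ = 𝟙 _ := F.universal.hom_ext (by
    have h1 : F.unit ≫ (sigOf j).map (F.desc t') = t' := F.universal.fac (StructuredArrow.mk t')
    have h2 : t' ≫ (sigOf j).map Ψ = F.unit := funext ht
    change F.unit ≫ (sigOf j).map (F.desc t' ≫ Ψ) = F.unit ≫ (sigOf j).map (𝟙 _)
    rw [(sigOf j).map_comp, ← Category.assoc, h1, h2, (sigOf j).map_id, Category.comp_id])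
  exact ⟨fun a => (F.desc t').hom.trans.app (j.obj a), fun a =>
    congrArg (fun g : F.monad ⟶ F.monad => g.hom.trans.app (j.obj a)) h⟩

end

variable {J : Type v} [EnrichedCategory V J] {j : EnrichedFunctor V J C} [HasEqualizers V]

/-- A generalized morphism between algebras for a free `J`-ary monad that is compatible with the
generating operations is compatible with all operations with arities in `J`. -/
theorem FreeJMonad.actThen_eq_thenAct (hC : IsCocomplete V C)
    (cot : ∀ (X : V) (A : C), Cotensor X A) (hj : IsDense j) (he : IsEleutheric j) {S : Sig j}
    (F : FreeJMonad j S) {X Y : F.monad.obj.Algebra} {Z : V} {f : Z ⟶ (X.A ⟶[V] Y.A)}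
    (h : ∀ a, actThen X Y f (j.obj a) ≫ homPre (F.unit a) Y.A =
      thenAct X Y f (j.obj a) ≫ homPre (F.unit a) Y.A) (a : J) :
    actThen X Y f (j.obj a) = thenAct X Y f (j.obj a) := by
  have hcot := fun (a : J) {K : C} {P : V} (x : P ⟶ (K ⟶[V] F.monad.obj.T.obj (j.obj a))) =>
    (cot ((j.obj a ⟶[V] X.A) ⊗ Z) Y.A).homPost_lift_eq_iff
      (actThen X Y f (j.obj a)) (thenAct X Y f (j.obj a)) x x
  have hmor : ∀ (a : J) {D : C} (g : Mor V D (F.monad.obj.T.obj (j.obj a))),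
      (g ⊛ actThen X Y f (j.obj a)) = (g ⊛ thenAct X Y f (j.obj a)) ↔
        actThen X Y f (j.obj a) ≫ homPre g Y.A = thenAct X Y f (j.obj a) ≫ homPre g Y.A :=
    fun a D g => by rw [mor_genComp, mor_genComp, cancel_epi]
  -- `E a` is the object of operations of arity `a` that `f` preserves.
  choose E σ hσ using fun a => hj.exists_isVEqualizer hC
    ((cot ((j.obj a ⟶[V] X.A) ⊗ Z) Y.A).lift ((λ_ _).hom ≫ actThen X Y f (j.obj a)))
    ((cot ((j.obj a ⟶[V] X.A) ⊗ Z) Y.A).lift ((λ_ _).hom ≫ thenAct X Y f (j.obj a)))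
  have hσ' : ∀ a, actThen X Y f (j.obj a) ≫ homPre (σ a) Y.A =
      thenAct X Y f (j.obj a) ≫ homPre (σ a) Y.A := fun a => by
    rw [← hmor, ← hcot, ← Mor.comp_eq_post, ← Mor.comp_eq_post, (hσ a).condition]
  choose unit hunit using fun a => (hσ a).exists_lift (F.monad.obj.η (j.obj a))
    ((hcot a _).2 ((hmor a _).2 (actThen_homPre_η _)))
  choose ext hext using fun a b => (hσ b).exists_lift (homPost (j.obj a) (σ b) ≫
    (F.monad.obj.freeAlgebra (j.obj b)).act (j.obj a) ≫ homPre (σ a) (F.monad.obj.T.obj (j.obj b)))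
    ((hcot b _).2 (ext_genComp_actThen (hσ' a) (hσ' b)))
  -- The hypothesis on `f` says exactly that the generators factor through `E`.
  choose s hs using fun a => (hσ a).exists_lift (F.unit a) ((hcot a _).2 ((hmor a _).2 (h a)))
  simp only [← Mor.comp_eq_post] at hunit hs
  let M : RelMonad j := RelMonad.ofSubobjects σ (fun X a => (hσ a).mono X) unit hunit ext hext
  obtain ⟨L⟩ := he.nonempty_kan M
  obtain ⟨Φ, hΦ⟩ := L.exists_hom (M := M) he hj hunit hext
  -- The cylinder at the identity of `j a` is the canonical morphism `E a ⟶ L (j a)`; followed by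
  -- `Φ` it is the inclusion `σ a`.
  have ht : ∀ a, (s a ⋄ (eId V (j.obj a) ≫ L.ι (j.obj a) a)) ⋄ Φ.trans.app (j.obj a) =
      F.unit a := fun a => by
    refine (Mor.assoc (s a) (eId V (j.obj a) ≫ L.ι (j.obj a) a) (Φ.trans.app (j.obj a))).trans ?_
    have e : (eId V (j.obj a) ≫ L.ι (j.obj a) a) ⋄ Φ.trans.app (j.obj a) = σ a := by
      rw [Mor.comp_eq_post, Category.assoc, hΦ, F.monad.obj.T.map_id_assoc, ← Mor.comp_eq_pre,
        Mor.comp_id]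
    exact (congrArg (fun t => s a ⋄ t) e).trans (hs a)
  obtain ⟨ψ, hψ⟩ := F.exists_section (N := L.monad he hj) Φ _ ht
  -- On the colimit `L (j a)` it suffices to compare along each `E b`; naturality in the arity
  -- reduces this to the defining equation of `E b`.
  have key : actThen X Y f (j.obj a) ≫ homPre (Φ.trans.app (j.obj a)) Y.A =
      thenAct X Y f (j.obj a) ≫ homPre (Φ.trans.app (j.obj a)) Y.A := by
    refine (L.isColimit (j.obj a)).hom_ext fun b => ?_
    rw [← homPost_genComp, ← homPost_genComp, hΦ, ← genComp_homPre, ← genComp_homPre,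
      map_genComp_actThen, map_genComp_thenAct, Category.assoc, Category.assoc, Category.assoc,
      Category.assoc, hσ']
  -- Since `ψ` is a section of `Φ`, restriction along `Φ` loses nothing.
  have hpre : homPre (Φ.trans.app (j.obj a)) Y.A ≫ homPre (ψ a) Y.A = 𝟙 _ :=
    (homPre_comp (ψ a) (Φ.trans.app (j.obj a)) Y.A).symm.trans
      ((congrArg (fun t => homPre t Y.A) (hψ a)).trans (homPre_id _ _))
  calc actThen X Y f (j.obj a)
      = actThen X Y f (j.obj a) ≫ homPre (Φ.trans.app (j.obj a)) Y.A ≫ homPre (ψ a) Y.A :=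
        ((congrArg _ hpre).trans (Category.comp_id _)).symm
    _ = thenAct X Y f (j.obj a) ≫ homPre (Φ.trans.app (j.obj a)) Y.A ≫ homPre (ψ a) Y.A :=
        (Category.assoc _ _ _).symm.trans ((congrArg (fun t => t ≫ homPre (ψ a) Y.A) key).trans
          (Category.assoc _ _ _))
    _ = thenAct X Y f (j.obj a) := (congrArg _ hpre).trans (Category.comp_id _)

theorem FreeJMonad.comp_homPre_eq (hC : IsCocomplete V C)
    (cot : ∀ (X : V) (A : C), Cotensor X A) (hj : IsDense j) (he : IsEleutheric j) {S : Sig j}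
    (F : FreeJMonad j S) {X Y : F.monad.obj.Algebra} {Z : V} {f : Z ⟶ (X.A ⟶[V] Y.A)}
    (h : ∀ a, actThen X Y f (j.obj a) ≫ homPre (F.unit a) Y.A =
      thenAct X Y f (j.obj a) ≫ homPre (F.unit a) Y.A) :
    f ≫ homPre X.a Y.A = f ≫ F.monad.obj.T.map X.A Y.A ≫ homPost (F.monad.obj.T.obj X.A) Y.a :=
  F.monad.property.actThen_eq hj (F.actThen_eq_thenAct hC cot hj he h)

end FreeMonads

/-! ### Isomorphisms and full subcategories in `V-CAT/C`. -/

section Slice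

variable {V : Type u} [Category.{v} V] [MonoidalCategory V]
variable {C : Type w} [EnrichedCategory V C]

namespace VCatOver

/-- Over `C`, the laws of a `V`-functor into a faithful `Y` hold automatically, since they hold
after composition with the monomorphisms to the hom-objects of `C`. -/
theorem exists_hom {X Y : VCatOver.{v, u, w, w₁} V C} (hY : ∀ a b, Mono (Y.functor.map a b))
    (φ : X.Obj → Y.Obj) (hφ : ∀ x, Y.functor.obj (φ x) = X.functor.obj x)
    (m : ∀ a b, ∃ m : (a ⟶[V] b) ⟶ (φ a ⟶[V] φ b), m ≫ Y.functor.map (φ a) (φ b) =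
      X.functor.map a b ≫ eqToHom (by rw [hφ, hφ])) :
    ∃ F : X ⟶ Y, F.fnctr.obj = φ := by
  revert φ
  obtain ⟨Xo, ⟨Fo, Fm, Fid, Fcomp⟩⟩ := X
  intro (φ : Xo → Y.Obj) (hφ : ∀ x : Xo, Y.functor.obj (φ x) = Fo x) m
  obtain rfl : Fo = fun x => Y.functor.obj (φ x) := funext fun x => (hφ x).symm
  choose m hm using m
  simp only [eqToHom_refl, Category.comp_id] at hm
  refine ⟨⟨⟨φ, m, fun a => ?_, fun a b c => ?_⟩, ?_⟩, rfl⟩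
  · have := hY (φ a) (φ a)
    rw [← cancel_mono (Y.functor.map (φ a) (φ a)), Category.assoc, hm, Y.functor.map_id]
    exact Fid a
  · have := hY (φ a) (φ c)
    rw [← cancel_mono (Y.functor.map (φ a) (φ c)), Category.assoc, hm, Category.assoc,
      Y.functor.map_comp, tensorHom_comp_tensorHom_assoc, hm, hm]
    exact Fcomp a b c
  · refine EnrichedFunctor.ext V (fun _ => rfl) fun a b => ?_
    exact (Category.comp_id _).trans (hm a b)

theorem hom_ext_of_faithful {X Y : VCatOver.{v, u, w, w₁} V C}
    (hY : ∀ a b, Mono (Y.functor.map a b)) {F G : X ⟶ Y}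
    (h : ∀ x, F.fnctr.obj x = G.fnctr.obj x) : F = G :=
  VCatOver.Hom.ext (EnrichedFunctor_eq_of_faithful Y.functor hY h (F.comm.trans G.comm.symm))

theorem nonempty_iso_of_bijective {X Y : VCatOver.{v, u, w, w₁} V C}
    (hX : ∀ a b, Mono (X.functor.map a b)) (hY : ∀ a b, Mono (Y.functor.map a b))
    (φ : X.Obj → Y.Obj) (hφ : Function.Bijective φ)
    (hobj : ∀ x, Y.functor.obj (φ x) = X.functor.obj x)
    (m : ∀ a b, ∃ m : (a ⟶[V] b) ⟶ (φ a ⟶[V] φ b), m ≫ Y.functor.map (φ a) (φ b) =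
      X.functor.map a b ≫ eqToHom (by rw [hobj, hobj]))
    (m' : ∀ a b, ∃ m : (φ a ⟶[V] φ b) ⟶ (a ⟶[V] b), m ≫ X.functor.map a b =
      Y.functor.map (φ a) (φ b) ≫ eqToHom (by rw [hobj, hobj])) : Nonempty (X ≅ Y) := by
  obtain ⟨F, hF⟩ := exists_hom hY φ hobj m
  obtain ⟨ψ, hψφ, hφψ⟩ := Function.bijective_iff_has_inverse.1 hφ
  have hobj' : ∀ y, X.functor.obj (ψ y) = Y.functor.obj y := fun y => by
    rw [← hobj, hφψ]
  obtain ⟨G, hG⟩ := exists_hom hX ψ hobj' fun a b => by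
    -- Stated for arbitrary `a = φ c`, `b = φ d`, so that the equalities `φ (ψ a) = a` can be
    -- eliminated.
    have key : ∀ (c d : X.Obj) (a b : Y.Obj) (hc : φ c = a) (hd : φ d = b),
        ∃ m : (a ⟶[V] b) ⟶ (c ⟶[V] d), m ≫ X.functor.map c d = Y.functor.map a b ≫
          eqToHom (by rw [← hc, ← hd, hobj, hobj]) := by
      rintro c d _ _ rfl rfl
      exact m' c d
    exact key (ψ a) (ψ b) a b (hφψ a) (hφψ b)
  refine ⟨⟨F, G, hom_ext_of_faithful hX fun x => ?_, hom_ext_of_faithful hY fun y => ?_⟩⟩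
  · change G.fnctr.obj (F.fnctr.obj x) = x
    rw [hF, hG, hψφ]
  · change F.fnctr.obj (G.fnctr.obj y) = y
    rw [hF, hG, hφψ]

/-- The inclusion of a full sub-`V`-category over `C`. -/
def fullι (X : VCatOver.{v, u, w, w₁} V C) (P : X.Obj → Prop) : X.full P ⟶ X :=
  VCatOver.Hom.mk (X := X.full P) (fullSubInclusion P) rfl

theorem fullι_cancel {W X : VCatOver.{v, u, w, w₁} V C} {P : X.Obj → Prop} {F G : W ⟶ X.full P}
    (h : F ≫ X.fullι P = G ≫ X.fullι P) : F = G := by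
  have h' : F.fnctr.comp V (fullSubInclusion P) = G.fnctr.comp V (fullSubInclusion P) :=
    congrArg VCatOver.Hom.fnctr h
  refine VCatOver.Hom.ext (EnrichedFunctor_eq_of_faithful (fullSubInclusion P)
    (fun a b => inferInstanceAs (Mono (𝟙 _))) (fun x => Subtype.ext ?_) h')
  exact congrFun (congrArg EnrichedFunctor.obj h') x

theorem exists_fullLift {W X : VCatOver.{v, u, w, w₁} V C} {P : X.Obj → Prop} (F : W ⟶ X)
    (h : ∀ x, P (F.fnctr.obj x)) : ∃ G : W ⟶ X.full P, G ≫ X.fullι P = F := by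
  let G : EnrichedFunctor V W.Obj (FullSub P) :=
    { obj := fun x => ⟨F.fnctr.obj x, h x⟩
      map := F.fnctr.map
      map_id := F.fnctr.map_id
      map_comp := F.fnctr.map_comp }
  have hG : G.comp V (fullSubInclusion P) = F.fnctr :=
    EnrichedFunctor.ext V (fun _ => rfl) fun a b => by
      refine (Category.comp_id _).trans ?_
      exact Category.comp_id _
  refine ⟨VCatOver.Hom.mk (Y := X.full P) G ?_, VCatOver.Hom.ext hG⟩
  refine (vfunctor_assoc G (fullSubInclusion P) X.functor).symm.trans ?_
  rw [hG, F.comm]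

theorem full_functor_mono {X : VCatOver.{v, u, w, w₁} V C} (hX : ∀ a b, Mono (X.functor.map a b))
    (P : X.Obj → Prop) (a b : (X.full P).Obj) : Mono ((X.full P).functor.map a b) := by
  have := hX a.1 b.1
  have e : (X.full P).functor.map a b = X.functor.map a.1 b.1 := Category.id_comp _
  rw [e]
  exact this

end VCatOver

end Slice

/-! ### Operations as morphisms out of tensors. -/

section Tensors

variable {V : Type u} [Category.{v} V] [MonoidalCategory V]
variable {C : Type w} [EnrichedCategory V C]

theorem Tensor.unit_homPost_desc {X : V} {M B : C} (t : Tensor X M) (k : X ⟶ (M ⟶[V] B)) :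
    t.unit ≫ homPost M (t.desc ((ρ_ X).hom ≫ k)) = k :=
  homPost_eq_of_genComp_eq (t.fac _)

theorem VMonad.Algebra.restrict_act {S T : VMonad V C} (τ : S ⟶ T) (X : T.Algebra) (D : C) :
    (X.restrict τ).act D = X.act D ≫ homPre (τ.trans.app D) X.A := by
  change S.T.map D X.A ≫ homPost (S.T.obj D) (τ.trans.app X.A ⋄ X.a) =
    (T.T.map D X.A ≫ homPost (T.T.obj D) X.a) ≫ homPre (τ.trans.app D) X.A
  rw [homPost_comp, ← Category.assoc, τ.trans.naturality, Category.assoc, homPre_homPost,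
    Category.assoc]

end Tensors

section Operations

variable {V : Type u} [Category.{v} V] [MonoidalCategory V] [MonoidalClosed V]
variable {C : Type w} [EnrichedCategory V C]

variable (ten : ∀ (X : V) (M : C), Tensor X M) (D M : C)

/-- The `V`-endofunctor `C(D, -) ⊗ M` of `C`. -/
abbrev homTensor : EnrichedFunctor V C C :=
  (homFunctor (V := V) D).comp V (tensorFunctor ten M)

/-- Seen through the units of the tensors, the action of `C(D, -) ⊗ M` is just composition in `C`.
-/
theorem unit_genComp_homTensor_map (A B : C) :
    ((ten (D ⟶[V] A) M).unit ⊛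
        ((homTensor ten D M).map A B : _ ⟶ ((ten (D ⟶[V] A) M).obj ⟶[V] (ten (D ⟶[V] B) M).obj))) =
      eComp V D A B ≫ (ten (D ⟶[V] B) M).unit := by
  have h : _ ◁ (homFunctor (V := V) D).map A B ≫ (ihom.ev (D ⟶[V] A)).app _ = eComp V D A B :=
    MonoidalClosed.whiskerLeft_curry_ihom_ev_app _ _ _
  refine (genComp_comp ((homFunctor (V := V) D).map A B) (ten (D ⟶[V] A) M).unit
    ((tensorFunctor ten M).map _ _)).trans ?_
  refine (congrArg (fun t => _ ◁ (homFunctor (V := V) D).map A B ≫ t)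
    ((ten (D ⟶[V] A) M).fac _)).trans ?_
  exact (Category.assoc _ _ _).symm.trans (congrArg (fun t => t ≫ _) h)

variable {D M}

/-- The morphism `C(D, A) ⊗ M ⟶ A` by which a family of operations `s : M ⟶ T D` acts on a
`T`-algebra `A`. -/
abbrev VMonad.Algebra.operation {T : VMonad V C} (X : T.Algebra) (s : Mor V M (T.T.obj D)) :
    Mor V (ten (D ⟶[V] X.A) M).obj X.A :=
  (ten (D ⟶[V] X.A) M).desc ((ρ_ (D ⟶[V] X.A)).hom ≫
    T.T.map D X.A ≫ homPost (T.T.obj D) X.a ≫ homPre s X.A)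

/-- Transposing along the tensor `C(D, X.A) ⊗ M` turns the two sides of the homomorphism condition
for one operation into `actThen` and `thenAct`, restricted along `s`. -/
theorem comp_homPre_operation_iff {T : VMonad V C} (s : Mor V M (T.T.obj D)) (X Y : T.Algebra)
    {Z : V} (f : Z ⟶ (X.A ⟶[V] Y.A)) :
    (f ≫ homPre (X.operation ten s) Y.A = f ≫ (homTensor ten D M).map X.A Y.A ≫
        homPost ((homTensor ten D M).obj X.A) (Y.operation ten s)) ↔
    actThen X Y f D ≫ homPre s Y.A = thenAct X Y f D ≫ homPre s Y.A := by
  have hX : ∀ X : T.Algebra, (ten (D ⟶[V] X.A) M).unit ≫ homPost M (X.operation ten s) =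
      X.act D ≫ homPre s X.A := fun X => by
    rw [VMonad.Algebra.operation, Tensor.unit_homPost_desc, VMonad.Algebra.act, Category.assoc]
  have h1 : ((ten (D ⟶[V] X.A) M).unit ⊛ f ≫ homPre (X.operation ten s) Y.A) =
      actThen X Y f D ≫ homPre s Y.A := by
    rw [← homPost_genComp, actThen, genComp_homPre, hX]
  obtain ⟨m, hm⟩ : ∃ m : (X.A ⟶[V] Y.A) ⟶
      ((ten (D ⟶[V] X.A) M).obj ⟶[V] (ten (D ⟶[V] Y.A) M).obj),
      m = (homTensor ten D M).map X.A Y.A := ⟨_, rfl⟩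
  have hunit : ((ten (D ⟶[V] X.A) M).unit ⊛ m) =
      eComp V D X.A Y.A ≫ (ten (D ⟶[V] Y.A) M).unit := by
    rw [hm]
    exact unit_genComp_homTensor_map ten D M X.A Y.A
  have h2 : ((ten (D ⟶[V] X.A) M).unit ⊛
      (f ≫ m) ≫ homPost (ten (D ⟶[V] X.A) M).obj (Y.operation ten s)) =
        thenAct X Y f D ≫ homPre s Y.A := by
    rw [← genComp_homPost, genComp_comp, hunit, ← id_genComp_id,
      ← Category.assoc (_ ◁ f), whiskerLeft_genComp, Category.comp_id, Category.assoc, hX, thenAct,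
      Category.assoc]
  rw [← h1, ← h2, hm]
  exact ⟨fun e => congrArg _ (e.trans (Category.assoc _ _ _).symm),
    fun e => ((ten (D ⟶[V] X.A) M).hom_ext e).trans (Category.assoc _ _ _)⟩

end Operations

/-! ### Satisfaction of equations and underlying `Σ`-algebras. -/

section Presentations

variable {V : Type u} [Category.{v} V] [MonoidalCategory V] [MonoidalClosed V]
  [SymmetricCategory V]
variable {C : Type w} [EnrichedCategory V C]

variable {J : Type v} [EnrichedCategory V J] {j : EnrichedFunctor V J C}

theorem satisfies_iff (cot : ∀ (X : V) (A : C), Cotensor X A) {T : JMonad j} (E : EquationSystem T)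
    (X : T.obj.Algebra) : E.Satisfies cot X ↔
      ∀ b, X.act (j.obj b) ≫ homPre (E.t b) X.A = X.act (j.obj b) ≫ homPre (E.u b) X.A := by
  have h : ∀ (b : J) {D : C} (t u : Mor V D (T.obj.T.obj (j.obj b))),
      t ⋄ interp cot X b = u ⋄ interp cot X b ↔
        X.act (j.obj b) ≫ homPre t X.A = X.act (j.obj b) ≫ homPre u X.A := fun b D t u => by
    have h := (cot (j.obj b ⟶[V] X.A) X.A).homPost_lift_eq_iff (X.act (j.obj b)) (X.act (j.obj b))
      t u
    rw [mor_genComp, mor_genComp, cancel_epi] at h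
    rw [← h, Mor.comp_eq_post, Mor.comp_eq_post]
    rfl
  exact forall_congr' fun b => h b (E.t b) (E.u b)

variable (ten : ∀ (X : V) (M : C), Tensor X M)

theorem sigHom_condition_iff {S : Sig j} {T : JMonad j} (s : S ⟶ (sigOf j).obj T)
    (X Y : T.obj.Algebra) {Z : V} (f : Z ⟶ (X.A ⟶[V] Y.A)) (c : J) :
    (f ≫ homPre ((underlyingSigAlgebra ten s X).a c) Y.A =
      f ≫ (sigFunctor ten S c).map X.A Y.A ≫
        homPost ((sigFunctor ten S c).obj X.A) ((underlyingSigAlgebra ten s Y).a c)) ↔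
    actThen X Y f (j.obj c) ≫ homPre (s c) Y.A = thenAct X Y f (j.obj c) ≫ homPre (s c) Y.A :=
  comp_homPre_operation_iff ten (s c) X Y f

variable [HasEqualizers V]

/-- If two structures `a`, `b` on one object have the same generating operations, the identity
commutes with those, hence is a homomorphism for the free monad, which says `a = b`. -/
theorem underlyingSigAlgebra_injective (hC : IsCocomplete V C)
    (cot : ∀ (X : V) (A : C), Cotensor X A) (hj : IsDense j) (he : IsEleutheric j) {S : Sig j}
    (F : FreeJMonad j S) : Function.Injective (underlyingSigAlgebra ten F.unit) := by
  have key : ∀ X Y : F.monad.obj.Algebra, ∀ f : Mor V X.A Y.A,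
      (∀ c, f ≫ homPre ((underlyingSigAlgebra ten F.unit X).a c) Y.A =
        f ≫ (sigFunctor ten S c).map X.A Y.A ≫ homPost ((sigFunctor ten S c).obj X.A)
          ((underlyingSigAlgebra ten F.unit Y).a c)) → X.a ⋄ f = mapMor F.monad.obj.T f ⋄ Y.a :=
    fun X Y f hf => by
      have h := F.comp_homPre_eq hC cot hj he (f := f) fun c =>
        (sigHom_condition_iff ten F.unit X Y f c).1 (hf c)
      rw [Mor.comp_eq_pre, Mor.comp_eq_post, mapMor, h, Category.assoc]
  rintro ⟨A, a, h1, h2⟩ ⟨B, b, h3, h4⟩ h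
  obtain rfl : A = B := congrArg SigAlgebra.A h
  have h' := key ⟨A, a, h1, h2⟩ ⟨A, b, h3, h4⟩ (eId V A) fun c => by
    have e : (underlyingSigAlgebra ten F.unit ⟨A, a, h1, h2⟩).a =
      (underlyingSigAlgebra ten F.unit ⟨A, b, h3, h4⟩).a := eq_of_heq ((SigAlgebra.ext_iff.1 h).2)
    rw [← e]
    exact hom_id (sigFunctor ten S c) _
  rw [Mor.comp_id, mapMor_id, Mor.id_comp] at h'
  subst h'
  rfl

/-- The generating operations of the restriction along `F.desc t` are the interpretations of the
terms `t b` in `X`. So satisfaction is equality of the two underlying `Γ`-algebras, and these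
determine the algebras for the free monad. -/
theorem satisfies_iff_restrict_eq (ten : ∀ (X : V) (M : C), Tensor X M) (hC : IsCocomplete V C)
    (cot : ∀ (X : V) (A : C), Cotensor X A) (hj : IsDense j) (he : IsEleutheric j) {T : JMonad j}
    (E : EquationSystem T) (F : FreeJMonad j E.Γ) (X : T.obj.Algebra) :
    E.Satisfies cot X ↔ X.restrict (F.desc E.t).hom = X.restrict (F.desc E.u).hom := by
  have hact : ∀ (t : E.Γ ⟶ (sigOf j).obj T) (b : J),
      (X.restrict (F.desc t).hom).act (j.obj b) ≫ homPre (F.unit b) X.A =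
        X.act (j.obj b) ≫ homPre (t b) X.A := fun t b => by
    have h : F.unit b ⋄ (F.desc t).hom.trans.app (j.obj b) = t b :=
      congrFun (F.universal.fac (StructuredArrow.mk t)) b
    refine (congrArg (fun k => k ≫ homPre (F.unit b) X.A)
      (VMonad.Algebra.restrict_act (F.desc t).hom X (j.obj b))).trans ?_
    exact (Category.assoc _ _ _).trans (congrArg (fun k => X.act (j.obj b) ≫ k)
      ((homPre_comp _ _ _).symm.trans (congrArg (fun k => homPre k X.A) h)))
  rw [satisfies_iff]
  refine ⟨fun h => ?_, fun h b => ?_⟩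
  · refine underlyingSigAlgebra_injective ten hC cot hj he F
      (SigAlgebra.ext rfl (heq_of_eq (funext fun b => ?_)))
    refine congrArg (fun k => (ten (j.obj b ⟶[V] X.A) (E.Γ b)).desc ((ρ_ _).hom ≫ k)) ?_
    have h' := ((hact E.t b).trans (h b)).trans (hact E.u b).symm
    exact (Category.assoc _ _ _).symm.trans (h'.trans (Category.assoc _ _ _))
  · have e : (X.restrict (F.desc E.t).hom).a = (X.restrict (F.desc E.u).hom).a :=
      eq_of_heq (VMonad.Algebra.ext_iff.1 h).2
    exact ((hact E.t b).symm.trans (congrArg (fun a : Mor V (F.monad.obj.T.obj X.A) X.A =>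
      (F.monad.obj.T.map (j.obj b) X.A ≫ homPost (F.monad.obj.T.obj (j.obj b)) a) ≫
        homPre (F.unit b) X.A) e)).trans (hact E.u b)

end Presentations

/-- A cone on the opposite of a parallel pair is determined by its component at `one`, so the limit
property is that of an equalizer. -/
theorem coequalizer_map_isLimit {D : Type w₁} [Category.{w₂} D] {K : Type w₃} [Category.{w} K]
    (G : Dᵒᵖ ⥤ K) {X Y Q : D} {f g : X ⟶ Y} {q : Y ⟶ Q} {hq : f ≫ q = g ≫ q}
    (h : IsLimit (G.mapCone (Cocone.op (Cofork.ofπ q hq)))) :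
    Mono (G.map q.op) ∧ ∀ {W : K} (k : W ⟶ G.obj (op Y)),
      k ≫ G.map f.op = k ≫ G.map g.op → ∃ l, l ≫ G.map q.op = k := by
  refine ⟨⟨fun a b e => h.hom_ext ?_⟩, fun {W} k hk => ?_⟩
  · have h1 : a ≫ (G.mapCone (Cocone.op (Cofork.ofπ q hq))).π.app (op WalkingParallelPair.one) =
        b ≫ (G.mapCone (Cocone.op (Cofork.ofπ q hq))).π.app (op WalkingParallelPair.one) := e
    rintro ⟨_ | _⟩
    · rw [← (G.mapCone (Cocone.op (Cofork.ofπ q hq))).w (Quiver.Hom.op WalkingParallelPairHom.left),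
        ← Category.assoc,
        h1, Category.assoc]
    · exact h1
  · let c : Cone ((parallelPair f g).op ⋙ G) :=
      { pt := W
        π :=
          { app := fun k' => match k' with
              | op WalkingParallelPair.zero => k ≫ G.map f.op
              | op WalkingParallelPair.one => k
            naturality := by
              rintro k' l' e
              obtain ⟨e, rfl⟩ : ∃ e', Quiver.Hom.op e' = e := ⟨e.unop, rfl⟩
              obtain ⟨k'⟩ := k'
              obtain ⟨l'⟩ := l'
              change WalkingParallelPairHom l' k' at e
              cases e with
              | left => exact Category.id_comp _
              | right => exact (Category.id_comp _).trans hk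
              | id =>
                exact (Category.id_comp _).trans ((Category.comp_id _).symm.trans
                  (congrArg (fun t => _ ≫ t) (((parallelPair f g).op ⋙ G).map_id _).symm)) } }
    exact ⟨h.lift c, h.fac c (op WalkingParallelPair.one)⟩

section Homs

variable {V : Type u} [Category.{v} V] [MonoidalCategory V]
variable {C : Type w} [EnrichedCategory V C]

/-- The easy converse to `IsJAry.actThen_eq`, valid for every `V`-monad and every arity. -/
theorem actThen_eq_of_comp_homPre_eq {T : VMonad V C} {X Y : T.Algebra} {Z : V}
    {f : Z ⟶ (X.A ⟶[V] Y.A)}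
    (h : f ≫ homPre X.a Y.A = f ≫ T.T.map X.A Y.A ≫ homPost (T.T.obj X.A) Y.a) (D : C) :
    actThen X Y f D = thenAct X Y f D := by
  rw [actThen, thenAct, VMonad.Algebra.genComp_act, Category.id_comp, VMonad.Algebra.act,
    VMonad.Algebra.act,
    ← h, homPost_genComp]

variable [HasEqualizers V]

theorem VMonad.exists_comp_algHoms_iff {T : VMonad V C} (X Y : T.Algebra) {Z : V}
    (f : Z ⟶ (X.A ⟶[V] Y.A)) : (∃ g, g ≫ T.algHoms.ι X Y = f) ↔
      f ≫ homPre X.a Y.A = f ≫ T.T.map X.A Y.A ≫ homPost (T.T.obj X.A) Y.a := by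
  refine ⟨?_, fun h => ⟨equalizer.lift f h, equalizer.lift_ι _ _⟩⟩
  rintro ⟨g, rfl⟩
  rw [Category.assoc, Category.assoc]
  exact congrArg _ (equalizer.condition _ _)

variable [MonoidalClosed V] [HasProducts.{v} V]
variable {J : Type v} [EnrichedCategory V J] {j : EnrichedFunctor V J C}

theorem exists_comp_sigHoms_iff {ten : ∀ (X : V) (M : C), Tensor X M} {S : Sig j}
    (X Y : SigAlgebra ten S) {Z : V}
    (f : Z ⟶ (X.A ⟶[V] Y.A)) : (∃ g, g ≫ (sigHoms ten S).ι X Y = f) ↔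
      ∀ c, f ≫ homPre (X.a c) Y.A =
        f ≫ (sigFunctor ten S c).map X.A Y.A ≫ homPost ((sigFunctor ten S c).obj X.A) (Y.a c) := by
  refine ⟨?_, fun h => ⟨equalizer.lift f (Pi.hom_ext _ _ fun c => ?_), equalizer.lift_ι _ _⟩⟩
  · rintro ⟨g, rfl⟩ c
    have h := equalizer.condition (Pi.lift fun c => homPre (X.a c) Y.A)
      (Pi.lift fun c => (sigFunctor ten S c).map X.A Y.A ≫
        homPost ((sigFunctor ten S c).obj X.A) (Y.a c)) =≫ Pi.π _ c
    simp only [Category.assoc, Pi.lift_π] at h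
    exact (Category.assoc _ _ _).trans ((congrArg (fun t => g ≫ t) h).trans
      (Category.assoc _ _ _).symm)
  · simp only [Category.assoc, Pi.lift_π]
    exact h c

end Homs

/-! ### The two isomorphisms. -/

section Semantics

variable {V : Type u} [Category.{v} V] [MonoidalCategory V] [MonoidalClosed V]
  [SymmetricCategory V] [HasEqualizers V]
variable {C : Type w} [EnrichedCategory V C]
variable {J : Type v} [EnrichedCategory V J] {j : EnrichedFunctor V J C}

/-- Both `V`-categories are subobjects of `T-Alg` in the slice; each inclusion factors through the
other, one by the full lift, one by the equalizer property. -/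
theorem EquationSystem.IsQuotient.nonempty_alg_iso (ten : ∀ (X : V) (M : C), Tensor X M)
    (hC : IsCocomplete V C) (cot : ∀ (X : V) (A : C), Cotensor X A) (hj : IsDense j)
    (he : IsEleutheric j) {T : JMonad j} {E : EquationSystem T} {S : JMonad j}
    (h : E.IsQuotient S) : Nonempty (S.obj.alg ≅ E.alg cot) := by
  obtain ⟨F, q, hq, -, ⟨hlim⟩⟩ := h
  have hT := T.obj.algHoms.mono
  let ι : E.alg cot ⟶ T.obj.alg := T.obj.alg.fullι (E.Satisfies cot)
  let r : S.obj.alg ⟶ T.obj.alg := (JAlg j).map q.op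
  -- Restricting along `q` and then along either induced morphism is restricting along one
  -- composite, as `q` coequalizes them.
  have hr : ∀ Y : S.obj.Algebra, E.Satisfies cot (Y.restrict q.hom) := fun Y => by
    rw [satisfies_iff_restrict_eq ten hC cot hj he E F]
    refine VMonad.Algebra.ext rfl (heq_of_eq ?_)
    have e : ∀ t : E.Γ ⟶ (sigOf j).obj T,
        (F.desc t).hom.trans.app Y.A ⋄ q.hom.trans.app Y.A ⋄ Y.a =
          (F.desc t ≫ q).hom.trans.app Y.A ⋄ Y.a := fun t => (Mor.assoc _ _ _).symm
    exact (e E.t).trans ((congrArg (fun k : F.monad ⟶ S => k.hom.trans.app Y.A ⋄ Y.a) hq).trans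
      (e E.u).symm)
  obtain ⟨a, ha⟩ : ∃ a : S.obj.alg ⟶ E.alg cot, a ≫ ι = r := VCatOver.exists_fullLift r hr
  have hι : ι ≫ (JAlg j).map (F.desc E.t).op = ι ≫ (JAlg j).map (F.desc E.u).op :=
    VCatOver.hom_ext_of_faithful F.monad.obj.algHoms.mono fun x =>
      (satisfies_iff_restrict_eq ten hC cot hj he E F x.1).1 x.2
  obtain ⟨hmono, hlift⟩ := coequalizer_map_isLimit (JAlg j) hlim
  obtain ⟨b, hb⟩ : ∃ b : E.alg cot ⟶ S.obj.alg, b ≫ r = ι := hlift ι hι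
  refine ⟨⟨a, b, hmono.right_cancellation _ _ ?_, VCatOver.fullι_cancel ?_⟩⟩
  · change (a ≫ b) ≫ r = 𝟙 _ ≫ r
    rw [Category.assoc, hb, ha, Category.id_comp]
  · change (b ≫ a) ≫ ι = 𝟙 _ ≫ ι
    rw [Category.assoc, ha, hb, Category.id_comp]

/-- Surjectivity on objects is built into the definition of `P`-algebras and injectivity is
`underlyingSigAlgebra_injective`. The hom-objects are subobjects of the same `C(A, B)`, and each
inclusion factors through the other. -/
theorem Presentation.nonempty_alg_iso [HasProducts.{v} V]
    (ten : ∀ (X : V) (M : C), Tensor X M)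
    (hC : IsCocomplete V C) (cot : ∀ (X : V) (A : C), Cotensor X A) (hj : IsDense j)
    (he : IsEleutheric j) (P : Presentation j) : Nonempty (P.E.alg cot ≅ P.alg cot ten) := by
  have hT := P.free.monad.obj.algHoms.mono
  have hS := (sigHoms ten P.sig).mono
  refine VCatOver.nonempty_iso_of_bijective (X := P.E.alg cot) (Y := P.alg cot ten)
    (VCatOver.full_functor_mono hT _) (VCatOver.full_functor_mono hS _)
    (fun Y => ⟨underlyingSigAlgebra ten P.free.unit Y.1, Y.1, rfl, Y.2⟩)
    ⟨fun X Y h => Subtype.ext (underlyingSigAlgebra_injective ten hC cot hj he P.free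
      (congrArg Subtype.val h)), ?_⟩ (fun _ => rfl) (fun X Y => ?_) fun X Y => ?_
  · rintro ⟨_, Y, rfl, hY⟩
    exact ⟨⟨Y, hY⟩, rfl⟩
  · obtain ⟨m, hm⟩ := (exists_comp_sigHoms_iff (underlyingSigAlgebra ten P.free.unit X.1)
      (underlyingSigAlgebra ten P.free.unit Y.1) (P.free.monad.obj.algHoms.ι X.1 Y.1)).2 fun c =>
        (sigHom_condition_iff ten P.free.unit X.1 Y.1 _ c).2 (congrArg (fun k => k ≫ _)
          (actThen_eq_of_comp_homPre_eq (equalizer.condition _ _) _))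
    exact ⟨m, ((congrArg _ (Category.id_comp _)).trans hm).trans
      ((Category.comp_id _).trans (Category.id_comp _)).symm⟩
  -- The substantial direction: the universal morphism of `Σ`-algebras commutes with the generators,
  -- hence with the whole free monad.
  · obtain ⟨m, hm⟩ := (VMonad.exists_comp_algHoms_iff X.1 Y.1 ((sigHoms ten P.sig).ι
      (underlyingSigAlgebra ten P.free.unit X.1) (underlyingSigAlgebra ten P.free.unit Y.1))).2
        (P.free.comp_homPre_eq hC cot hj he fun c =>
          (sigHom_condition_iff ten P.free.unit X.1 Y.1 _ c).1
            ((exists_comp_sigHoms_iff _ _ _).1 ⟨𝟙 _, Category.id_comp _⟩ c))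
    exact ⟨m, ((congrArg _ (Category.id_comp _)).trans hm).trans
      ((Category.comp_id _).trans (Category.id_comp _)).symm⟩

end Semantics

end

end JAry

theorem theorem9p2p12
    {V : Type u} [Category.{v} V] [MonoidalCategory V] [SymmetricCategory V] [MonoidalClosed V]
    [HasLimitsOfSize.{v, v} V] [HasColimitsOfSize.{v, v} V]
    {C : Type w} [EnrichedCategory V C] (hC : IsCocomplete V C)
    (cot : ∀ (X : V) (A : C), Cotensor X A) (ten : ∀ (X : V) (M : C), Tensor X M)
    {J : Type v} [EnrichedCategory V J] (j : EnrichedFunctor V J C)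
    (hj : IsSubcategoryOfArities j) (he : IsEleutheric j) :
    (∀ (T : JMonad j) (E : EquationSystem T) (S : JMonad j), E.IsQuotient S →
      Nonempty (S.obj.alg ≅ E.alg cot)) ∧
    (∀ (P : Presentation j) (S : JMonad j), P.Presents S →
      Nonempty (S.obj.alg ≅ P.alg cot ten)) :=
  ⟨fun _ _ _ h => h.nonempty_alg_iso ten hC cot hj.dense he, fun P _ h => by
    obtain ⟨e⟩ := EquationSystem.IsQuotient.nonempty_alg_iso ten hC cot hj.dense he h
    obtain ⟨e'⟩ := P.nonempty_alg_iso ten hC cot hj.dense he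
    exact ⟨e ≪≫ e'⟩⟩
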